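/- Let $p$ be a prime, and let $K$ be a local field of characteristic $p$ (complete with respect to a normalized discrete valuation) with perfect residue field $\mathbb F$, viewed as a subfield of $K$ via $K\cong\mathbb F((t))$. Let $n\ge1$ and let $L/K$ be a totally ramified Galois extension with group $G\cong C_p^n$ having a single (lower) ramification break $b>0$; let $v_L$ be the normalized valuation of $L$. Let $R=\mathbb F[G]$, acting on $L$ by $\bigl(\sum c_\sigma\sigma\bigr)(x)=\sum c_\sigma\sigma(x)$, let $A$ be its augmentation ideal, fix $k$ with $2\le k\le p$ and put $\bar R=R/A^k$. The group $(1+A)/(1+A^k)$, identified with the image of $1+A$ in $\bar R^\times$, is an $\mathbb F$-vector space with scalar multiplication $\omega\cdot\bar\gamma=\bar\gamma^{[\omega]}$, where $\gamma^{[\omega]}=\sum_{i=0}^{p-1}\binom{\omega}{i}(\gamma-1)^i$ and $\binom{\omega}{i}=\omega(\omega-1)\cdots(\omega-i+1)/i!$. Let $\bar G^{[\mathbb F]}$ be the $\mathbb F$-span of the image of $G$. An element $\rho\in L^\times$ is a valuation criterion element if $v_L(\rho)\equiv b\pmod{p^n}$. For such $\rho$ put $i_\rho(\bar\gamma)=\max\{v_L((\gamma'-1)(\rho)):\gamma'\in\bar\gamma\}$;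 the set of $(\rho,k)$-refined breaks of $L/K$ is $$B_{\rho,k}=\{i_\rho(\bar\gamma)-v_L(\rho):\bar\gamma\in\bar G^{[\mathbb F]},\ \bar\gamma\ne\bar1\}.$$ The $VC_k$-refined breaks of $L/K$ are defined if $B_{\rho,k}$ is the same set for all valuation criterion elements $\rho$, and they are then the elements of this set. For $\gamma\in R$ put $\hat v_L(\gamma)=\min\{v_L(\gamma(x))-v_L(x):x\in L^\times\}$ and for $\bar\gamma\in\bar R$ put $\hat v_L(\bar\gamma)=\max\{\hat v_L(\gamma'):\gamma'\in\bar\gamma\}$. For an integer $h\ge0$ let $\bar G^{[\mathbb F]}_h$ be the $\mathbb F$-subspace $\{\bar\gamma\in\bar G^{[\mathbb F]}:\hat v_L(\bar\gamma-\bar1)\ge h\}$. An integer $h\ge0$ is an $SS_k$-refined break of $L/K$ if $\bar G^{[\mathbb F]}_{h+1}\ne\bar G^{[\mathbb F]}_h$, and its multiplicity is $\dim_{\mathbb F}\bigl(\bar G^{[\mathbb F]}_h/\bar G^{[\mathbb F]}_{h+1}\bigr)$. Then: 1. For every valuation criterion element $\rho$ there are exactly $n$ distinct $(\rho,k)$-refined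 breaks $b_0<b_1<\dots<b_{n-1}$, all of them integers, and $b_i\le bp^i$ for $0\le i<n$. 2. Counted with multiplicity there are exactly $n$ $SS_k$-refined breaks $b_0\le b_1\le\dots\le b_{n-1}$, and $b_i\le bp^i$ for $0\le i<n$. 3. If the $VC_k$-refined breaks of $L/K$ are defined, there are exactly $n$ of them, $b_0'<b_1'<\dots<b_{n-1}'$, and $b_i'\le bp^i$ for $0\le i<n$. -/

import Mathlib

open Polynomial
open scoped WithZero Valued IsMulCommutative

noncomputable section

namespace RefinedBreaks

/-! ### Truncated powers -/

section Truncated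

variable {F S : Type*} [Field F] [CommRing S] [Algebra F S]

/-- The binomial coefficient `ω (ω - 1) ⋯ (ω - (i - 1)) / i!`, meant for `i!` invertible in `F`. -/
def binom (ω : F) (i : ℕ) : F :=
  (∏ j ∈ Finset.range i, (ω - (j : F))) / ((Nat.factorial i : ℕ) : F)

/-- The truncated power `x^[ω] = ∑_{i < p} binom(ω, i) (x - 1)^i`. -/
def truncPow (p : ℕ) (ω : F) (x : S) : S :=
  ∑ i ∈ Finset.range p, binom ω i • (x - 1) ^ i

/-- `f` is a polynomial function of degree `< p`, tested by linear functionals. -/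
def IsPolyFun (p : ℕ) (f : F → S) : Prop :=
  ∀ φ : S →ₗ[F] F, ∃ Q : F[X], Q.natDegree < p ∧ ∀ ω, φ (f ω) = Q.eval ω

theorem IsPolyFun.sum {p : ℕ} (hp : 0 < p) {ι : Type*} (s : Finset ι) (f : ι → F → S)
    (h : ∀ i ∈ s, IsPolyFun p (f i)) : IsPolyFun p (fun ω => ∑ i ∈ s, f i ω) := by
  classical
  intro φ
  have h2 : ∀ i, ∃ Q : F[X], i ∈ s → Q.natDegree < p ∧ ∀ ω, φ (f i ω) = Q.eval ω := by
    intro i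
    by_cases hi : i ∈ s
    · obtain ⟨Q, hQ⟩ := h i hi φ
      exact ⟨Q, fun _ => hQ⟩
    · exact ⟨0, fun h => absurd h hi⟩
  choose Q hQ using h2
  refine ⟨∑ i ∈ s, Q i, ?_, ?_⟩
  · refine lt_of_le_of_lt (natDegree_sum_le_of_forall_le (n := p - 1) s Q ?_) (by omega)
    intro i hi
    have := (hQ i hi).1
    omega
  · intro ω
    rw [map_sum, eval_finsetSum]
    exact Finset.sum_congr rfl fun i hi => (hQ i hi).2 ω

theorem IsPolyFun.eval_smul {p : ℕ} (Q : F[X]) (hQ : Q.natDegree < p) (s : S) :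
    IsPolyFun p (fun ω => Q.eval ω • s) := by
  intro φ
  refine ⟨C (φ s) * Q, lt_of_le_of_lt (natDegree_C_mul_le _ _) hQ, fun ω => ?_⟩
  simp [mul_comm]

theorem IsPolyFun.ext {p : ℕ} [Fact p.Prime] [CharP F p] {f g : F → S} (hf : IsPolyFun p f)
    (hg : IsPolyFun p g) (h : ∀ m : ℕ, f m = g m) (ω : F) : f ω = g ω := by
  rw [← sub_eq_zero, ← Module.forall_dual_apply_eq_zero_iff F]
  intro φ
  obtain ⟨P, hP, hP'⟩ := hf φ
  obtain ⟨Q, hQ, hQ'⟩ := hg φ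
  have : P = Q := by
    refine eq_of_natDegree_lt_card_of_eval_eq P Q (f := fun i : Fin p => ((i : ℕ) : F)) ?_ ?_ ?_
    · intro i j hij
      exact Fin.ext (CharP.natCast_injOn_Iio F p i.2 j.2 hij)
    · intro i
      rw [← hP', ← hQ', h]
    · simpa using ⟨hP, hQ⟩
  rw [map_sub, hP', hQ', this, sub_self]

/-- `binom ω i` as a polynomial in `ω`. -/
def binomPoly (F : Type*) [Field F] (i : ℕ) : F[X] :=
  C (((Nat.factorial i : ℕ) : F)⁻¹) * ∏ j ∈ Finset.range i, (X - C (j : F))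

theorem eval_binomPoly (i : ℕ) (ω : F) : (binomPoly F i).eval ω = binom ω i := by
  simp [binomPoly, binom, eval_prod, div_eq_mul_inv, mul_comm]

theorem natDegree_binomPoly_le (i : ℕ) : (binomPoly F i).natDegree ≤ i := by
  refine (natDegree_C_mul_le _ _).trans ?_
  rw [natDegree_prod_of_monic _ _ (fun j _ => monic_X_sub_C _)]
  simp only [natDegree_X_sub_C]
  simp

theorem binom_natCast {p : ℕ} [Fact p.Prime] [CharP F p] (m : ℕ) {i : ℕ} (hi : i < p) :
    binom (m : F) i = (m.choose i : F) := by
  have h0 : ((Nat.factorial i : ℕ) : F) ≠ 0 := by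
    rw [Ne, CharP.cast_eq_zero_iff F p, (Fact.out : p.Prime).dvd_factorial]
    omega
  rw [binom, div_eq_iff h0, ← Nat.cast_mul, mul_comm, ← Nat.descFactorial_eq_factorial_mul_choose]
  clear hi h0
  induction i with
  | zero => simp
  | succ i ih =>
    rw [Finset.prod_range_succ, ih, Nat.descFactorial_succ, Nat.cast_mul, mul_comm]
    rcases le_or_gt i m with h | h
    · rw [Nat.cast_sub h]
    · simp [Nat.descFactorial_of_lt h]

theorem truncPow_natCast {p : ℕ} [Fact p.Prime] [CharP F p] {x : S} (hx : (x - 1) ^ p = 0)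
    (m : ℕ) : truncPow p (m : F) x = x ^ m := by
  have h1 : truncPow p (m : F) x = ∑ i ∈ Finset.range p, (m.choose i : S) * (x - 1) ^ i := by
    refine Finset.sum_congr rfl fun i hi => ?_
    rw [binom_natCast m (Finset.mem_range.1 hi), Nat.cast_smul_eq_nsmul, nsmul_eq_mul]
  have h2 : x ^ m = ∑ i ∈ Finset.range (m + 1), (m.choose i : S) * (x - 1) ^ i := by
    conv_lhs => rw [show x = (x - 1) + 1 by ring, add_pow]
    exact Finset.sum_congr rfl fun i _ => by simp [mul_comm]
  have h3 : ∀ i, p ≤ i → (m.choose i : S) * (x - 1) ^ i = 0 := fun i hi => by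
    rw [← Nat.sub_add_cancel hi, pow_add, hx, mul_zero, mul_zero]
  have h4 : ∀ i, m + 1 ≤ i → (m.choose i : S) * (x - 1) ^ i = 0 := fun i hi => by
    rw [Nat.choose_eq_zero_of_lt (by omega)]; simp
  rw [h1, h2, Finset.sum_subset (Finset.range_mono (le_max_left p (m + 1)))
      fun i _ hi => h3 i (by simpa using hi),
    Finset.sum_subset (Finset.range_mono (le_max_right p (m + 1)))
      fun i _ hi => h4 i (by simpa using hi)]

theorem isPolyFun_truncPow_affine {p : ℕ} [Fact p.Prime] (a b : F) (x : S) :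
    IsPolyFun p (fun ω => truncPow p (a * ω + b) x) := by
  refine IsPolyFun.sum (Fact.out : p.Prime).pos _ _ fun i hi => ?_
  have := IsPolyFun.eval_smul (p := p) ((binomPoly F i).comp (C a * X + C b)) ?_ ((x - 1) ^ i)
  · simpa [eval_comp, eval_binomPoly] using this
  · refine lt_of_le_of_lt natDegree_comp_le ?_
    have h1 : (C a * X + C b : F[X]).natDegree ≤ 1 := natDegree_linear_le
    have h2 := natDegree_binomPoly_le (F := F) i
    have h3 := Finset.mem_range.1 hi
    nlinarith

theorem isPolyFun_truncPow {p : ℕ} [Fact p.Prime] (x : S) :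
    IsPolyFun p (fun ω : F => truncPow p ω x) := by
  simpa using isPolyFun_truncPow_affine (p := p) (1 : F) 0 x

theorem isPolyFun_mul_const {p : ℕ} {f : F → S} (hf : IsPolyFun p f) (s : S) :
    IsPolyFun p (fun ω => f ω * s) := fun φ => hf (φ ∘ₗ LinearMap.mulRight F s)

theorem truncPow_add {p : ℕ} [Fact p.Prime] [CharP F p] {x : S} (hx : (x - 1) ^ p = 0)
    (ω ω' : F) : truncPow p (ω + ω') x = truncPow p ω x * truncPow p ω' x := by
  have key : ∀ (m : ℕ) (ω' : F), truncPow p ((m : F) + ω') x = x ^ m * truncPow p ω' x := by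
    intro m ω'
    refine IsPolyFun.ext (p := p) (f := fun ω' => truncPow p ((m : F) + ω') x)
      (g := fun ω' => x ^ m * truncPow p ω' x) ?_ ?_ ?_ ω'
    · simpa [add_comm] using isPolyFun_truncPow_affine (p := p) (1 : F) (m : F) x
    · simpa [mul_comm] using isPolyFun_mul_const (isPolyFun_truncPow (F := F) (p := p) x) (x ^ m)
    · intro m'
      rw [← Nat.cast_add, truncPow_natCast hx, truncPow_natCast hx, pow_add]
  refine IsPolyFun.ext (p := p) (f := fun ω => truncPow p (ω + ω') x)
      (g := fun ω => truncPow p ω x * truncPow p ω' x) ?_ ?_ ?_ ω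
  · simpa using isPolyFun_truncPow_affine (p := p) (1 : F) ω' x
  · exact isPolyFun_mul_const (isPolyFun_truncPow (F := F) (p := p) x) _
  · intro m
    rw [key, truncPow_natCast hx]

theorem truncPow_zero {p : ℕ} [Fact p.Prime] [CharP F p] {x : S} (hx : (x - 1) ^ p = 0) :
    truncPow p (0 : F) x = 1 := by
  simpa using truncPow_natCast (F := F) hx 0

theorem truncPow_one {p : ℕ} [Fact p.Prime] [CharP F p] {x : S} (hx : (x - 1) ^ p = 0) :
    truncPow p (1 : F) x = x := by
  simpa using truncPow_natCast (F := F) hx 1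

theorem truncPow_base_one {p : ℕ} [Fact p.Prime] [CharP F p] (ω : F) :
    truncPow p ω (1 : S) = 1 := by
  have hp := (Fact.out : p.Prime)
  refine IsPolyFun.ext (p := p) (f := fun ω => truncPow p ω (1 : S)) (g := fun _ => 1)
    (isPolyFun_truncPow _) ?_ ?_ ω
  · simpa using IsPolyFun.eval_smul (p := p) (1 : F[X]) (by simpa using hp.pos) (1 : S)
  · intro m
    rw [truncPow_natCast (by simp [hp.ne_zero]), one_pow]

theorem truncPow_natCast_mul {p : ℕ} [Fact p.Prime] [CharP F p] {x : S} (hx : (x - 1) ^ p = 0)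
    (m : ℕ) (ω : F) : truncPow p ((m : F) * ω) x = truncPow p ω x ^ m := by
  induction m with
  | zero => simpa using truncPow_zero hx
  | succ m ih => rw [Nat.cast_succ, add_mul, one_mul, truncPow_add hx, ih, pow_succ]

theorem truncPow_sub_one_mem {p : ℕ} [Fact p.Prime] (I : Ideal S) {x : S} (hx : x - 1 ∈ I)
    (ω : F) : truncPow p ω x - 1 ∈ I := by
  obtain ⟨q, rfl⟩ : ∃ q, p = q + 1 :=
    Nat.exists_eq_succ_of_ne_zero (Fact.out : p.Prime).ne_zero
  rw [truncPow, Finset.sum_range_succ']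
  have : binom ω 0 • (x - 1) ^ 0 = 1 := by simp [binom]
  rw [this, add_sub_cancel_right]
  refine Ideal.sum_mem _ fun i _ => ?_
  rw [Algebra.smul_def]
  exact Ideal.mul_mem_left _ _ (Ideal.pow_mem_of_mem _ hx _ (Nat.succ_pos _))

theorem sub_one_pow_eq_zero {p : ℕ} {I : Ideal S} (hI : I ^ p = ⊥) {x : S} (hx : x - 1 ∈ I) :
    (x - 1) ^ p = 0 := by
  have := Ideal.pow_mem_pow hx p
  rwa [hI] at this

theorem truncPow_mul_exp {p : ℕ} [Fact p.Prime] [CharP F p] {I : Ideal S} (hI : I ^ p = ⊥)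
    {x : S} (hx : x - 1 ∈ I) (ω ω' : F) :
    truncPow p (ω * ω') x = truncPow p ω (truncPow p ω' x) := by
  have hx' := truncPow_sub_one_mem (p := p) I hx ω'
  refine IsPolyFun.ext (p := p) (f := fun ω => truncPow p (ω * ω') x)
    (g := fun ω => truncPow p ω (truncPow p ω' x)) ?_ (isPolyFun_truncPow _) ?_ ω
  · simpa [mul_comm] using isPolyFun_truncPow_affine (p := p) ω' 0 x
  · intro m
    rw [truncPow_natCast_mul (sub_one_pow_eq_zero hI hx),
      truncPow_natCast (sub_one_pow_eq_zero hI hx')]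

theorem mul_sub_one_mem {I : Ideal S} {x y : S} (hx : x - 1 ∈ I) (hy : y - 1 ∈ I) :
    x * y - 1 ∈ I := by
  have : x * y - 1 = x * (y - 1) + (x - 1) := by ring
  rw [this]
  exact I.add_mem (I.mul_mem_left _ hy) hx

theorem truncPow_base_mul {p : ℕ} [Fact p.Prime] [CharP F p] {I : Ideal S} (hI : I ^ p = ⊥)
    {x y : S} (hx : x - 1 ∈ I) (hy : y - 1 ∈ I) (ω : F) :
    truncPow p ω (x * y) = truncPow p ω x * truncPow p ω y := by
  have hp := (Fact.out : p.Prime).pos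
  refine IsPolyFun.ext (p := p) (f := fun ω => truncPow p ω (x * y))
    (g := fun ω => truncPow p ω x * truncPow p ω y) (isPolyFun_truncPow _) ?_ ?_ ω
  · simp only [truncPow, Finset.sum_mul_sum]
    refine IsPolyFun.sum hp _ _ fun i _ => IsPolyFun.sum hp _ _ fun j _ => ?_
    by_cases hij : i + j < p
    · have := IsPolyFun.eval_smul (p := p) (binomPoly F i * binomPoly F j)
        (lt_of_le_of_lt (natDegree_mul_le.trans
          (add_le_add (natDegree_binomPoly_le i) (natDegree_binomPoly_le j))) hij)
        ((x - 1) ^ i * (y - 1) ^ j)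
      simpa only [eval_mul, eval_binomPoly, smul_mul_smul_comm] using this
    · have h0 : (x - 1) ^ i * (y - 1) ^ j = 0 := by
        have h1 : (x - 1) ^ i * (y - 1) ^ j ∈ I ^ (i + j) := by
          rw [pow_add]
          exact Ideal.mul_mem_mul (Ideal.pow_mem_pow hx i) (Ideal.pow_mem_pow hy j)
        have h2 := Ideal.pow_le_pow_right (I := I) (not_lt.1 hij) h1
        rwa [hI] at h2
      have := IsPolyFun.eval_smul (p := p) (0 : F[X]) (by simpa using hp) (0 : S)
      simpa [smul_mul_smul_comm, h0] using this
  · intro m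
    rw [truncPow_natCast (sub_one_pow_eq_zero hI (mul_sub_one_mem hx hy)),
      truncPow_natCast (sub_one_pow_eq_zero hI hx), truncPow_natCast (sub_one_pow_eq_zero hI hy),
      mul_pow]

/-- The group `1 + I` of units congruent to `1` modulo `I`. -/
def principalUnits (I : Ideal S) : Subgroup Sˣ where
  carrier := {u | (u : S) - 1 ∈ I}
  one_mem' := by simp
  mul_mem' := fun {u v} hu hv => by
    simpa using mul_sub_one_mem (I := I) (x := (u : S)) (y := (v : S)) hu hv
  inv_mem' := fun {u} hu => by
    have h : ((u⁻¹ : Sˣ) : S) - 1 = -((u⁻¹ : Sˣ) : S) * ((u : S) - 1) := by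
      rw [mul_sub, neg_mul, Units.inv_mul]; ring
    change ((u⁻¹ : Sˣ) : S) - 1 ∈ I
    rw [h]
    exact I.mul_mem_left _ hu

/-- The truncated power of an element of `1 + I`, as an element of `1 + I`, when `I ^ p = 0`. -/
def principalUnits.tpow {p : ℕ} [Fact p.Prime] [CharP F p] {I : Ideal S} (hI : I ^ p = ⊥) (ω : F)
    (u : principalUnits I) : principalUnits I :=
  ⟨{ val := truncPow p ω ((u : Sˣ) : S)
     inv := truncPow p (-ω) ((u : Sˣ) : S)
     val_inv := by
      have h := sub_one_pow_eq_zero hI u.2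
      rw [← truncPow_add h, add_neg_cancel, truncPow_zero h]
     inv_val := by
      have h := sub_one_pow_eq_zero hI u.2
      rw [← truncPow_add h, neg_add_cancel, truncPow_zero h] },
    truncPow_sub_one_mem I u.2 ω⟩

end Truncated

/-! ### The group ring modulo a power of the augmentation ideal -/

section GroupRing

variable (p k : ℕ) (F G : Type*) [Field F] [CommGroup G]

/-- The augmentation ideal `A` of `R = F[G]`: the kernel of `∑ c_σ σ ↦ ∑ c_σ`. -/
def augIdeal : Ideal (MonoidAlgebra F G) :=
  RingHom.ker (MonoidAlgebra.lift F F G (1 : G →* F))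

/-- The ring `R / A^k`. -/
abbrev GroupRingQuot : Type _ := MonoidAlgebra F G ⧸ (augIdeal F G) ^ k

/-- The image of `A` in `R / A^k`. -/
def augIdealQuot : Ideal (GroupRingQuot k F G) :=
  (augIdeal F G).map (Ideal.Quotient.mk _)

theorem augIdealQuot_pow (h : k ≤ p) : augIdealQuot k F G ^ p = ⊥ := by
  rw [augIdealQuot, ← Ideal.map_pow, Ideal.map_eq_bot_iff_le_ker, Ideal.mk_ker]
  exact Ideal.pow_le_pow_right h

/-- The group `(1 + A) / (1 + A^k)`, realized as the image of `1 + A` in `(R / A^k)ˣ` and written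
additively. For `k ≤ p = char F` it is an `F`-vector space with `ω • u = u^[ω]`; the parameter `p`
only records the truncation degree used for this scalar multiplication. -/
def TruncGroup : Type _ :=
  let _ := p
  Additive (principalUnits (augIdealQuot k F G))

instance : AddCommGroup (TruncGroup p k F G) :=
  inferInstanceAs (AddCommGroup (Additive (principalUnits (augIdealQuot k F G))))

variable {p k F G}

/-- An element of `(1 + A) / (1 + A^k)` as an element of `R / A^k`. -/
def TruncGroup.val (u : TruncGroup p k F G) : GroupRingQuot k F G :=
  ((Additive.toMul (α := principalUnits (augIdealQuot k F G)) u : (GroupRingQuot k F G)ˣ) :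
    GroupRingQuot k F G)

theorem TruncGroup.val_injective :
    Function.Injective (TruncGroup.val : TruncGroup p k F G → GroupRingQuot k F G) :=
  fun _ _ h => Subtype.ext (Units.ext h)

theorem TruncGroup.val_add (u v : TruncGroup p k F G) : (u + v).val = u.val * v.val := rfl

theorem TruncGroup.val_zero : (0 : TruncGroup p k F G).val = 1 := rfl

theorem TruncGroup.val_mem (u : TruncGroup p k F G) : u.val - 1 ∈ augIdealQuot k F G :=
  (Additive.toMul (α := principalUnits (augIdealQuot k F G)) u).2

instance [Fact p.Prime] [CharP F p] [hk : Fact (k ≤ p)] : SMul F (TruncGroup p k F G) where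
  smul ω u := Additive.ofMul (α := principalUnits (augIdealQuot k F G))
    (principalUnits.tpow (augIdealQuot_pow p k F G hk.out) ω (Additive.toMul u))

theorem TruncGroup.val_smul [Fact p.Prime] [CharP F p] [Fact (k ≤ p)] (ω : F)
    (u : TruncGroup p k F G) : (ω • u).val = truncPow p ω u.val := rfl

/-- The `F`-vector space structure on `(1 + A) / (1 + A^k)` given by truncated powers. -/
instance [Fact p.Prime] [CharP F p] [hk : Fact (k ≤ p)] : Module F (TruncGroup p k F G) where
  one_smul u := TruncGroup.val_injective <| by
    rw [TruncGroup.val_smul, truncPow_one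
      (sub_one_pow_eq_zero (augIdealQuot_pow p k F G hk.out) u.val_mem)]
  mul_smul ω ω' u := TruncGroup.val_injective <| by
    simp only [TruncGroup.val_smul]
    exact truncPow_mul_exp (augIdealQuot_pow p k F G hk.out) u.val_mem ω ω'
  smul_zero ω := TruncGroup.val_injective <| by
    rw [TruncGroup.val_smul, TruncGroup.val_zero, truncPow_base_one]
  smul_add ω u v := TruncGroup.val_injective <| by
    simp only [TruncGroup.val_smul, TruncGroup.val_add]
    exact truncPow_base_mul (augIdealQuot_pow p k F G hk.out) u.val_mem v.val_mem ω
  add_smul ω ω' u := TruncGroup.val_injective <| by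
    simp only [TruncGroup.val_smul, TruncGroup.val_add]
    exact truncPow_add (sub_one_pow_eq_zero (augIdealQuot_pow p k F G hk.out) u.val_mem) ω ω'
  zero_smul u := TruncGroup.val_injective <| by
    rw [TruncGroup.val_smul, TruncGroup.val_zero, truncPow_zero
      (sub_one_pow_eq_zero (augIdealQuot_pow p k F G hk.out) u.val_mem)]

/-- The class of `σ ∈ G` in `(1 + A) / (1 + A^k)`. -/
def groupElt (p k : ℕ) (F : Type*) {G : Type*} [Field F] [CommGroup G] (σ : G) :
    TruncGroup p k F G :=
  Additive.ofMul (α := principalUnits (augIdealQuot k F G))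
    ⟨Units.map (Ideal.Quotient.mk (augIdeal F G ^ k) : MonoidAlgebra F G →* GroupRingQuot k F G)
        (Units.map (MonoidAlgebra.of F G) (toUnits σ)), by
      have h : MonoidAlgebra.of F G σ - 1 ∈ augIdeal F G := by
        rw [augIdeal, RingHom.mem_ker]
        simp [MonoidAlgebra.lift_single]
      have h2 := Ideal.mem_map_of_mem (Ideal.Quotient.mk (augIdeal F G ^ k)) h
      rw [map_sub, map_one] at h2
      exact h2⟩

/-- The `F`-span of the image of `G` in `(1 + A) / (1 + A^k)`. -/
def groupSpan (p k : ℕ) (F G : Type*) [Field F] [CommGroup G] [Fact p.Prime] [CharP F p]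
    [Fact (k ≤ p)] : Submodule F (TruncGroup p k F G) :=
  Submodule.span F (Set.range (groupElt p k F (G := G)))

end GroupRing

/-! ### Local fields -/

/-- The additive valuation `v : L → ℤ ∪ {∞}` attached to a `ℤᵐ⁰`-valued valuation on `L`. -/
def ord {L : Type*} [Field L] [Valued L ℤᵐ⁰] (x : L) : WithTop ℤ :=
  open Classical in if x = 0 then ⊤ else ((-WithZero.log (Valued.v x) : ℤ) : WithTop ℤ)

/-- For a complete discretely valued field `K` of characteristic `p` with perfect residue field,
the largest perfect subfield `⋂ₘ K^(p^m)`. It is the unique subfield of `K` which maps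
isomorphically onto the residue field (so `K = F((t))` with `F` this subfield), and it is used to
view the residue field as a subfield of `K`. -/
def coeffField (p : ℕ) [Fact p.Prime] (K : Type*) [Field K] [CharP K p] : Subfield K :=
  ⨅ m : ℕ, (iterateFrobenius K p m).fieldRange

instance (p : ℕ) [Fact p.Prime] (K : Type*) [Field K] [CharP K p] : CharP (coeffField p K) p :=
  CharP.subring K p (coeffField p K).toSubring

section Ramification

variable (K L : Type*) [Field K] [Field L] [Algebra K L] [Valued L ℤᵐ⁰]

/-- The lower ramification group `G_i = {σ | v(σ x - x) ≥ i + 1 for all x with v(x) ≥ 0}`. -/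
def lowerRamification (i : ℤ) : Set Gal(L/K) :=
  {σ | ∀ x : L, 0 ≤ ord x → ((i + 1 : ℤ) : WithTop ℤ) ≤ ord (σ x - x)}

/-- The set of lower ramification breaks of `L / K`. -/
def lowerBreaks : Set ℤ :=
  {i | -1 ≤ i ∧ lowerRamification K L i ≠ lowerRamification K L (i + 1)}

/-- `L / K` is totally ramified: for normalized valuations, the valuation of `L` extends that of `K`
with ramification index `[L : K]`. -/
def IsTotallyRamified [Valued K ℤᵐ⁰] : Prop :=
  ∀ x : K, (Valued.v (algebraMap K L x) : ℤᵐ⁰) = (Valued.v x : ℤᵐ⁰) ^ Module.finrank K L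

end Ramification

section Breaks

variable (p k : ℕ) (K L : Type*) [Fact p.Prime] [Fact (k ≤ p)]
  [Field K] [CharP K p] [Field L] [Algebra K L] [IsAbelianGalois K L] [Valued L ℤᵐ⁰]

/-- The group ring `F[Gal(L/K)]`, where `F` is the residue field of `K` viewed inside `K`. -/
abbrev GalRing : Type _ := MonoidAlgebra (coeffField p K) Gal(L/K)

/-- The quotient of `F[Gal(L/K)]` by the `k`-th power of its augmentation ideal. -/
abbrev GalRingQuot : Type _ := GroupRingQuot k (coeffField p K) Gal(L/K)

variable {p k K L}

/-- The action `γ(x) = ∑ c_σ σ(x)` of `γ = ∑ c_σ σ ∈ F[Gal(L/K)]` on `x ∈ L`. -/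
def act (γ : GalRing p K L) (x : L) : L :=
  γ.coeff.sum fun σ c => algebraMap K L (c : K) * σ x

/-- The elements of the coset `γ + A^k`. -/
def reps (γ : GalRingQuot p k K L) : Set (GalRing p K L) :=
  {γ' | Ideal.Quotient.mk (augIdeal (coeffField p K) Gal(L/K) ^ k) γ' = γ}

/-- `i_ρ(γ) = max {v_L((γ' - 1)(ρ)) : γ' ∈ γ}` for a coset `γ` modulo `A^k`. -/
def iRho (ρ : L) (γ : GalRingQuot p k K L) : WithTop ℤ :=
  sSup ((fun γ' : GalRing p K L => ord (act (γ' - 1) ρ)) '' reps γ)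

/-- `v̂_L(γ) = min {v_L(γ(x)) - v_L(x) : x ∈ Lˣ}` for `γ ∈ F[Gal(L/K)]`. -/
def vHat (γ : GalRing p K L) : WithTop ℤ :=
  sInf {m | ∃ x : L, x ≠ 0 ∧ m = ord (act γ x) - ord x}

/-- `v̂_L(γ) = max {v̂_L(γ') : γ' ∈ γ}` for a coset `γ` modulo `A^k`. -/
def vHatQuot (γ : GalRingQuot p k K L) : WithTop ℤ :=
  sSup (vHat '' reps γ)

variable (p k K L)

/-- The set of `(ρ, k)`-refined breaks of `L / K`:
the values `i_ρ(γ) - v_L(ρ)` for `γ ≠ 1` in the span of the image of `Gal(L/K)`. -/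
def refinedBreaks (ρ : L) : Set (WithTop ℤ) :=
  {h | ∃ γ ∈ groupSpan p k (coeffField p K) Gal(L/K), γ ≠ 0 ∧ h = iRho ρ γ.val - ord ρ}

/-- The `h`-th step of the smallest-shift filtration of the span of the image of `Gal(L/K)`:
those `γ` with `v̂_L(γ - 1) ≥ h`. -/
def ssFiltration (h : ℕ) : Set (TruncGroup p k (coeffField p K) Gal(L/K)) :=
  {γ | γ ∈ groupSpan p k (coeffField p K) Gal(L/K) ∧
    ((h : ℤ) : WithTop ℤ) ≤ vHatQuot (γ.val - 1)}

/-- The set of `SS_k`-refined breaks of `L / K`. -/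
def ssBreaks : Set ℕ :=
  {h | ssFiltration p k K L (h + 1) ≠ ssFiltration p k K L h}

/-- The multiplicity of an `SS_k`-refined break `h`: the dimension over `F` of the quotient of the
`h`-th step of the smallest-shift filtration by the next one. (The steps are subspaces, so taking
spans changes nothing.) -/
def ssMultiplicity (h : ℕ) : ℕ :=
  Module.finrank (coeffField p K)
    (Submodule.span (coeffField p K) (ssFiltration p k K L h) ⧸
      (Submodule.span (coeffField p K) (ssFiltration p k K L (h + 1))).submoduleOf
        (Submodule.span (coeffField p K) (ssFiltration p k K L h)))

/-- `ρ` is a valuation criterion element of `L / K`, where `b` is the only ramification break. -/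
def IsValuationCriterion (b : ℕ) (ρ : L) : Prop :=
  ∃ m : ℤ, ord ρ = (m : WithTop ℤ) ∧ m ≡ b [ZMOD (Module.finrank K L : ℤ)]

/-- The `VC_k`-refined breaks of `L / K` are defined: the set of `(ρ, k)`-refined breaks
is the same for all valuation criterion elements `ρ`. -/
def VCBreaksDefined (b : ℕ) : Prop :=
  ∀ ρ ρ' : L, IsValuationCriterion K L b ρ → IsValuationCriterion K L b ρ' →
    refinedBreaks p k K L ρ = refinedBreaks p k K L ρ'

/-- The set of `VC_k`-refined breaks of `L / K`; it is the set of `(ρ, k)`-refined breaks for any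
valuation criterion element `ρ` whenever the latter does not depend on `ρ`. -/
def vcBreaks (b : ℕ) : Set (WithTop ℤ) :=
  {h | ∃ ρ : L, IsValuationCriterion K L b ρ ∧ h ∈ refinedBreaks p k K L ρ}

end Breaks

end RefinedBreaks

end

/-!
Write `v` for the normalized valuation of `L`, `N = p ^ n` for the degree, `F` for the coefficient
field, `A` for the augmentation ideal of `F[G]`, and let `σ_0, …, σ_{n-1}` be a basis of `G`. All
three parts follow from one upper bound for the shift of the valuation of a well chosen `ρ` under
elements of `A`, and a dimension count.

*Lower bounds for shifts.* If `y` is fixed by a subgroup `H` of `G`, then `v(σ y - y) ≥ v(y) + b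
|H|` for every `σ` in `G` (`le_ord_galois_sub_of_fixed`). For integral `y = g(π)` the polynomial
`g - σ(y)` vanishes at all `σ τ π` with `τ` in `H`, so `y - σ(y)` is divisible by the product of
the `π - σ τ π`; the general case follows because the relation in question is multiplicative in
`y`. Hence an element of `A` shifts the valuation of an element fixed by `σ_j` for all `j` in `S`
by at least `b p ^ |S|`.

*The trace.* The norm element `∑ σ` is the product of the `(σ_j - 1) ^ (p - 1)`. Applying its
factors one after the other, each to an element fixed by more of the `σ_j`, the lower bounds add
up to `v(Tr y) ≥ v(y) + b (N - 1)`. When `v(ρ) ≡ b` modulo `N` this is an equality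
(`ord_trace_of_modEq`): up to terms of higher valuation `ρ` is a `K`-multiple of Euler's element
`π ^ (N - 1) / f'(π)` of trace `1`, where `f` is the minimal polynomial of `π`. So for such a `ρ`
every intermediate lower bound is an equality too.

*The upper bound* (`ord_act_le`). Modulo `A ^ 2` an element `α` of `A` is a linear combination of
the `σ_j - 1`. If its coefficients vanish outside `S ∪ {l}` and that of `σ_l - 1` does not, then
applying the product of the `(σ_j - 1) ^ (p - 1)` over `j` in `S` leaves `σ_l - 1` as the leading
term, whose shift is known exactly. This gives `v(α ρ) ≤ v(ρ) + b p ^ |S|`. The coefficients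
depend only on the class of `1 + α` modulo `A ^ k`, and on the span of the image of `G` they are
coordinates (`groupSpanEquiv`).

*Counting.* Both kinds of breaks are jumps of a decreasing filtration of the `n`-dimensional span
of the image of `G` (`breakFiltration`). By the upper bound the step with index `b p ^ i + 1`
meets the subspace of classes with vanishing coordinates beyond the `i`-th one trivially, so its
dimension is at most `n - 1 - i`; this is the bound `b_i ≤ b p ^ i` (`exists_breaks`). For the
filtration by the valuation at `ρ` each jump has dimension one, since the residue field of `L` is
`F` and truncated powers have the expected leading terms (`finrank_breakFiltration_ord_le`); hence
the breaks are distinct there. For the smallest-shift filtration the power `π ^ b` serves as `ρ`.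
-/

namespace RefinedBreaks

/-! ### The additive valuation -/

section Ord

variable {L : Type*} [Field L] [Valued L ℤᵐ⁰]

theorem ord_zero : ord (0 : L) = ⊤ := by simp [ord]

theorem ord_of_ne_zero {x : L} (hx : x ≠ 0) :
    ord x = ((-WithZero.log (Valued.v x) : ℤ) : WithTop ℤ) := by simp [ord, hx]

theorem le_ord_iff {x : L} {m : ℤ} : (m : WithTop ℤ) ≤ ord x ↔ Valued.v x ≤ WithZero.exp (-m) := by
  rcases eq_or_ne x 0 with rfl | hx
  · simp [ord_zero]
  · rw [ord_of_ne_zero hx, WithTop.coe_le_coe, ← WithZero.log_le_iff_le_exp (by simpa using hx)]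
    omega

theorem exists_ord_eq {x : L} (hx : x ≠ 0) : ∃ m : ℤ, ord x = m := ⟨_, ord_of_ne_zero hx⟩

theorem withTop_le_of_forall_coe_le {x y : WithTop ℤ}
    (h : ∀ m : ℤ, (m : WithTop ℤ) ≤ x → (m : WithTop ℤ) ≤ y) :
    x ≤ y := by
  induction x with
  | top =>
    induction y with
    | top => exact le_rfl
    | coe y =>
      have := h (y + 1) le_top
      rw [WithTop.coe_le_coe] at this
      omega
  | coe x => exact h x le_rfl

variable (L) in
/-- The function `ord` as an additive valuation. -/
noncomputable def ordVal : AddValuation L (WithTop ℤ) :=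
  AddValuation.of ord ord_zero (by simp [ord])
    (fun x y => withTop_le_of_forall_coe_le fun m hm => by
      rw [le_min_iff, le_ord_iff, le_ord_iff] at hm
      exact le_ord_iff.2 ((Valuation.map_add _ x y).trans (max_le hm.1 hm.2)))
    (fun x y => by
      rcases eq_or_ne x 0 with rfl | hx
      · simp [ord_zero]
      rcases eq_or_ne y 0 with rfl | hy
      · simp [ord_zero]
      rw [ord_of_ne_zero hx, ord_of_ne_zero hy, ord_of_ne_zero (mul_ne_zero hx hy), map_mul,
        WithZero.log_mul (by simpa using hx) (by simpa using hy), ← WithTop.coe_add]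
      congr 1
      ring)

theorem ordVal_apply (x : L) : ordVal L x = ord x := rfl

theorem ord_mul (x y : L) : ord (x * y) = ord x + ord y := (ordVal L).map_mul x y

theorem ord_one : ord (1 : L) = 0 := (ordVal L).map_one

theorem ord_neg (x : L) : ord (-x) = ord x := (ordVal L).map_neg x

theorem ord_sub_swap (x y : L) : ord (x - y) = ord (y - x) := (ordVal L).map_sub_swap x y

theorem ord_eq_top_iff {x : L} : ord x = ⊤ ↔ x = 0 := (ordVal L).top_iff

theorem ord_pow (x : L) (n : ℕ) : ord (x ^ n) = n • ord x := (ordVal L).map_pow x n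

theorem le_ord_add {x y : L} {g : WithTop ℤ} (hx : g ≤ ord x) (hy : g ≤ ord y) :
    g ≤ ord (x + y) := (ordVal L).map_le_add hx hy

theorem le_ord_sub {x y : L} {g : WithTop ℤ} (hx : g ≤ ord x) (hy : g ≤ ord y) :
    g ≤ ord (x - y) := (ordVal L).map_le_sub hx hy

theorem lt_ord_add {x y : L} {g : WithTop ℤ} (hx : g < ord x) (hy : g < ord y) :
    g < ord (x + y) := (ordVal L).map_lt_add hx hy

theorem le_ord_sum {ι : Type*} {s : Finset ι} {f : ι → L} {g : WithTop ℤ}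
    (hf : ∀ i ∈ s, g ≤ ord (f i)) : g ≤ ord (∑ i ∈ s, f i) := (ordVal L).map_le_sum hf

theorem ord_add_eq_left {x y : L} (h : ord x < ord y) : ord (x + y) = ord x :=
  (ordVal L).map_add_eq_of_lt_left h

theorem ord_prod {ι : Type*} (s : Finset ι) (f : ι → L) :
    ord (∏ i ∈ s, f i) = ∑ i ∈ s, ord (f i) := by
  classical
  induction s using Finset.induction with
  | empty => simp [ord_one]
  | insert a s ha ih => rw [Finset.prod_insert ha, Finset.sum_insert ha, ord_mul, ih]

theorem ord_inv {x : L} {m : ℤ} (h : ord x = m) : ord x⁻¹ = ((-m : ℤ) : WithTop ℤ) := by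
  have hx : x ≠ 0 := by rw [Ne, ← ord_eq_top_iff, h]; exact WithTop.coe_ne_top
  rw [ord_of_ne_zero hx, WithTop.coe_inj] at h
  rw [ord_of_ne_zero (inv_ne_zero hx), map_inv₀, WithZero.log_inv, h]

theorem ord_zpow {x : L} {m : ℤ} (h : ord x = m) (n : ℤ) :
    ord (x ^ n) = ((n * m : ℤ) : WithTop ℤ) := by
  have hx : x ≠ 0 := by rw [Ne, ← ord_eq_top_iff, h]; exact WithTop.coe_ne_top
  rw [ord_of_ne_zero hx, WithTop.coe_inj] at h
  rw [ord_of_ne_zero (zpow_ne_zero _ hx), map_zpow₀, WithZero.log_zpow, ← h]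
  simp

theorem zero_le_ord_iff {x : L} : 0 ≤ ord x ↔ Valued.v x ≤ 1 := by
  simpa using le_ord_iff (x := x) (m := 0)

theorem zero_lt_ord_iff {x : L} : 0 < ord x ↔ Valued.v x < 1 := by
  rcases eq_or_ne x 0 with rfl | hx
  · simp [ord_zero]
  · have h := WithZero.log_lt_iff_lt_exp (x := (Valued.v x : ℤᵐ⁰)) (a := 0) (by simpa using hx)
    rw [WithZero.exp_zero] at h
    rw [ord_of_ne_zero hx, ← h, ← WithTop.coe_zero, WithTop.coe_lt_coe]
    omega

theorem coe_add_one_le_iff {m : ℤ} {x : WithTop ℤ} :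
    ((m + 1 : ℤ) : WithTop ℤ) ≤ x ↔ (m : WithTop ℤ) < x := by
  induction x with
  | top => simp
  | coe x => rw [WithTop.coe_le_coe, WithTop.coe_lt_coe]; omega

end Ord

/-! ### Residue classes are represented by the coefficient field -/

section Coeff

variable (p : ℕ) [Fact p.Prime] {K : Type*} [Field K] [CharP K p] [Valued K ℤᵐ⁰]

theorem ord_coeffField (c : coeffField p K) (hc : c ≠ 0) : ord (c : K) = 0 := by
  have hc' : (c : K) ≠ 0 := by simpa using hc
  obtain ⟨m, hm⟩ := exists_ord_eq hc'
  have hp := (Fact.out : p.Prime)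
  -- `c` is a `p ^ j`-th power for every `j`
  have h : ∀ j : ℕ, ((p ^ j : ℕ) : ℤ) ∣ m := fun j => by
    have h1 : (c : K) ∈ (iterateFrobenius K p j).fieldRange := by
      have := c.2
      simp only [coeffField, Subfield.mem_iInf] at this
      exact this j
    obtain ⟨d, hd⟩ := h1
    rw [iterateFrobenius_def] at hd
    have hd0 : d ≠ 0 := by
      rintro rfl
      rw [zero_pow (pow_ne_zero _ hp.ne_zero)] at hd
      exact hc' hd.symm
    obtain ⟨l, hl⟩ := exists_ord_eq hd0
    rw [← hd, ord_pow, hl, ← WithTop.coe_nsmul, WithTop.coe_inj] at hm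
    exact ⟨l, by rw [← hm]; simp⟩
  have h0 : m = 0 := by
    have h1 := h m.natAbs
    refine Int.eq_zero_of_abs_lt_dvd h1 ?_
    rw [Int.abs_eq_natAbs]
    exact_mod_cast Nat.lt_pow_self hp.one_lt
  rw [hm, h0]; rfl

/-- In a perfect residue field, every residue class is a `p`-th power. -/
theorem exists_pow_sub_ord_pos [PerfectField 𝓀[K]] (a : K) (ha : 0 ≤ ord a) :
    ∃ r : K, 0 ≤ ord r ∧ 0 < ord (r ^ p - a) := by
  have hp := (Fact.out : p.Prime)
  have : CharP 𝓀[K] p := by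
    rw [CharP.charP_iff_prime_eq_zero hp]
    have : ((p : 𝒪[K]) : 𝒪[K]) = 0 := by
      apply Subtype.ext
      simp
    rw [← map_natCast (IsLocalRing.residue 𝒪[K]), this, map_zero]
  have : ExpChar 𝓀[K] p := ExpChar.prime hp
  have : PerfectRing 𝓀[K] p := PerfectField.toPerfectRing p
  let a' : 𝒪[K] := ⟨a, zero_le_ord_iff.1 ha⟩
  obtain ⟨s, hs⟩ := surjective_frobenius 𝓀[K] p (IsLocalRing.residue 𝒪[K] a')
  obtain ⟨r, rfl⟩ := IsLocalRing.residue_surjective s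
  refine ⟨r, zero_le_ord_iff.2 r.2, ?_⟩
  rw [frobenius_def, ← map_pow, ← sub_eq_zero, ← map_sub, IsLocalRing.residue_eq_zero_iff] at hs
  rw [zero_lt_ord_iff]
  refine lt_of_le_of_ne (zero_le_ord_iff.1 ?_) fun h1 => ?_
  · exact zero_le_ord_iff.2 (r ^ p - a').2
  · exact (IsLocalRing.mem_maximalIdeal _).1 hs
      ((Valuation.Integers.isUnit_iff_valuation_eq_one (Valuation.integer.integers _)).2 h1)

theorem exists_tendsto_of_le_ord [CompleteSpace K] (x : ℕ → K)
    (h : ∀ m : ℕ, ((m : ℤ) : WithTop ℤ) ≤ ord (x (m + 1) - x m)) :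
    ∃ l : K, Filter.Tendsto x Filter.atTop (nhds l) := by
  have h2 : ∀ i j : ℕ, ((i : ℤ) : WithTop ℤ) ≤ ord (x (i + j) - x i) := by
    intro i j
    induction j with
    | zero => simp [ord_zero]
    | succ j ih =>
      rw [← sub_add_sub_cancel (x (i + (j + 1))) (x (i + j)) (x i)]
      refine le_ord_add (le_trans ?_ (h (i + j))) ih
      exact_mod_cast Nat.le_add_right i j
  refine cauchySeq_tendsto_of_complete ?_
  rw [(Valued.hasBasis_uniformity K ℤᵐ⁰).cauchySeq_iff']
  intro γ _
  set g : ℤᵐ⁰ := MonoidWithZeroHom.ValueGroup₀.embedding γ.1 with hg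
  have hg0 : g ≠ 0 := by rw [hg]; simp
  -- beyond this index the differences have valuation smaller than `g`
  refine ⟨(1 - WithZero.log g).toNat, fun n hn => ?_⟩
  rw [Set.mem_ofPred_eq, Valuation.restrict_lt_iff_lt_embedding, ← hg]
  obtain ⟨j, rfl⟩ := Nat.exists_eq_add_of_le hn
  have h3 := h2 (1 - WithZero.log g).toNat j
  rw [ord_sub_swap] at h3
  refine lt_of_le_of_lt (le_ord_iff.1 h3) ?_
  rw [← WithZero.lt_log_iff_exp_lt hg0]
  omega

/-- The coefficient field surjects onto the residue field: a limit of `p ^ m`-th powers of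
lifts of `p ^ m`-th roots of a residue class is a `p ^ m`-th power for every `m`. -/
theorem exists_coeffField_sub_ord_pos [CompleteSpace K] [PerfectField 𝓀[K]] (a : K)
    (ha : 0 ≤ ord a) : ∃ c : coeffField p K, 0 < ord (a - c) := by
  have hp := (Fact.out : p.Prime)
  choose r hr0 hr using fun a : {a : K // 0 ≤ ord a} => exists_pow_sub_ord_pos p a.1 a.2
  -- `s m` lifts a `p ^ m`-th root of the residue class of `a`
  let s : ℕ → {a : K // 0 ≤ ord a} :=
    fun m => Nat.rec ⟨a, ha⟩ (fun _ b => ⟨r b, hr0 b⟩) m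
  have hs : ∀ m, 0 < ord ((s (m + 1)).1 ^ p - (s m).1) := fun m => hr (s m)
  -- `z j` converges to a `p ^ j`-th root of the limit of `z 0`
  let z : ℕ → ℕ → K := fun j m => (s (j + m)).1 ^ p ^ m
  have hz : ∀ j m, ((p ^ m : ℕ) : ℤ) ≤ ord (z j (m + 1) - z j m) := fun j m => by
    have h1 : z j (m + 1) - z j m = ((s (j + m + 1)).1 ^ p - (s (j + m)).1) ^ p ^ m := by
      rw [sub_pow_char_pow, ← pow_mul, ← pow_succ']
      rfl
    have h2 : ((1 : ℤ) : WithTop ℤ) ≤ ord ((s (j + m + 1)).1 ^ p - (s (j + m)).1) := by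
      have := coe_add_one_le_iff.2 (show ((0 : ℤ) : WithTop ℤ) < _ from hs (j + m))
      simpa using this
    rw [h1, ord_pow]
    refine le_trans (le_of_eq ?_) (nsmul_le_nsmul_right h2 (p ^ m))
    rw [← WithTop.coe_nsmul]
    simp
  choose l hl using fun j => exists_tendsto_of_le_ord (z j) fun m =>
    le_trans (by exact_mod_cast (Nat.lt_pow_self hp.one_lt).le) (hz j m)
  have hl1 : ∀ j, l j = l (j + 1) ^ p := fun j => by
    refine tendsto_nhds_unique ((Filter.tendsto_add_atTop_iff_nat 1).2 (hl j)) ?_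
    refine ((hl (j + 1)).pow p).congr fun m => ?_
    change ((s (j + 1 + m)).1 ^ p ^ m) ^ p = (s (j + (m + 1))).1 ^ p ^ (m + 1)
    rw [← pow_mul, ← pow_succ, add_assoc j 1 m, add_comm 1 m]
  have hl2 : ∀ m j, l j = l (j + m) ^ p ^ m := fun m => by
    induction m with
    | zero => simp
    | succ m ih => intro j; rw [ih j, hl1, ← pow_mul, ← pow_succ', add_assoc]
  refine ⟨⟨l 0, ?_⟩, ?_⟩
  · simp only [coeffField, Subfield.mem_iInf]
    exact fun m => ⟨l (0 + m), by rw [iterateFrobenius_def, ← hl2]⟩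
  · have h1 : ∀ m, 0 < ord (z 0 m - a) := fun m => by
      induction m with
      | zero => simp [z, s, ord_zero]
      | succ m ih =>
        rw [← sub_add_sub_cancel _ (z 0 m) a]
        refine lt_ord_add (lt_of_lt_of_le ?_ (hz 0 m)) ih
        exact_mod_cast pow_pos hp.pos m
    have h2 : {y : K | Valued.v (y - l 0) < 1} ∈ nhds (l 0) := by
      rw [Valued.mem_nhds]
      exact ⟨1, fun y hy => by simpa using hy⟩
    obtain ⟨m, hm⟩ := ((hl 0).eventually h2).exists
    change 0 < ord (a - l 0)
    rw [← neg_sub, ord_neg, ← sub_add_sub_cancel _ (z 0 m) a]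
    refine lt_ord_add ?_ (h1 m)
    rw [ord_sub_swap]
    exact zero_lt_ord_iff.2 hm

end Coeff

/-! ### Totally ramified extensions -/

section Uniformizer

variable {L : Type*} [Field L] [Valued L ℤᵐ⁰]

theorem exists_ord (hL : Function.Surjective (Valued.v : Valuation L ℤᵐ⁰)) (m : ℤ) :
    ∃ x : L, ord x = m := by
  obtain ⟨x, hx⟩ := hL (WithZero.exp (-m))
  have hx0 : x ≠ 0 := by
    rintro rfl
    rw [map_zero] at hx
    exact WithZero.exp_ne_zero hx.symm
  exact ⟨x, by rw [ord_of_ne_zero hx0, hx, WithZero.log_exp, neg_neg]⟩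

theorem ne_zero_of_ord {x : L} {m : ℤ} (h : ord x = m) : x ≠ 0 := by
  rw [Ne, ← ord_eq_top_iff, h]
  exact WithTop.coe_ne_top

theorem ord_pow_uniformizer {π : L} (hπ : ord π = ((1 : ℤ) : WithTop ℤ)) (i : ℕ) :
    ord (π ^ i) = ((i : ℤ) : WithTop ℤ) := by
  rw [ord_pow, hπ, ← WithTop.coe_nsmul]; simp

/-- A sum of terms with pairwise distinct valuations has valuation at most that of each term. -/
theorem ord_sum_le_of_distinct {ι : Type*} (s : Finset ι) (f : ι → L)
    (h : ∀ i ∈ s, ∀ j ∈ s, i ≠ j → f i ≠ 0 → ord (f i) ≠ ord (f j)) {j : ι} (hj : j ∈ s) :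
    ord (∑ i ∈ s, f i) ≤ ord (f j) := by
  classical
  obtain ⟨i, hi, hmin⟩ := s.exists_min_image (fun i => ord (f i)) ⟨j, hj⟩
  refine le_trans ?_ (hmin j hj)
  by_cases h0 : f i = 0
  · simp [h0, ord_zero]
  rw [← Finset.add_sum_erase s f hi, ord_add_eq_left]
  refine (ordVal L).map_lt_sum (by rwa [Ne, ord_eq_top_iff]) fun l hl => ?_
  exact lt_of_le_of_ne (hmin l (Finset.mem_of_mem_erase hl))
    (h i hi l (Finset.mem_of_mem_erase hl) (Finset.ne_of_mem_erase hl).symm h0)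

end Uniformizer

section Extension

variable {K L : Type*} [Field K] [Valued K ℤᵐ⁰] [Field L] [Valued L ℤᵐ⁰] [Algebra K L]

theorem ord_algebraMap (hram : IsTotallyRamified K L) {x : K} {m : ℤ} (hx : ord x = m) :
    ord (algebraMap K L x) = ((Module.finrank K L * m : ℤ) : WithTop ℤ) := by
  have hx0 := ne_zero_of_ord hx
  rw [ord_of_ne_zero hx0, WithTop.coe_inj] at hx
  rw [ord_of_ne_zero (by simpa using hx0), hram, WithZero.log_pow, ← hx]
  simp

theorem zero_le_ord_algebraMap (hram : IsTotallyRamified K L) {x : K} (hx : 0 ≤ ord x) :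
    0 ≤ ord (algebraMap K L x) := by
  rcases eq_or_ne x 0 with rfl | hx0
  · simp [ord_zero]
  obtain ⟨m, hm⟩ := exists_ord_eq hx0
  rw [ord_algebraMap hram hm]
  rw [hm] at hx
  norm_cast at hx ⊢
  positivity

/-- The valuation of a power of a uniformizer times an element of the base field. -/
theorem ord_algebraMap_mul_pow (hram : IsTotallyRamified K L) {π : L}
    (hπ : ord π = ((1 : ℤ) : WithTop ℤ)) {x : K} {m : ℤ} (hx : ord x = m) (i : ℕ) :
    ord (algebraMap K L x * π ^ i) = ((Module.finrank K L * m + i : ℤ) : WithTop ℤ) := by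
  rw [ord_mul, ord_algebraMap hram hx, ord_pow_uniformizer hπ, WithTop.coe_add]

theorem ord_sum_mul_pow_le (hram : IsTotallyRamified K L) {π : L}
    (hπ : ord π = ((1 : ℤ) : WithTop ℤ)) (a : Fin (Module.finrank K L) → K)
    (j : Fin (Module.finrank K L)) :
    ord (∑ i, algebraMap K L (a i) * π ^ (i : ℕ)) ≤ ord (algebraMap K L (a j) * π ^ (j : ℕ)) := by
  refine ord_sum_le_of_distinct Finset.univ (fun i => algebraMap K L (a i) * π ^ (i : ℕ)) ?_
    (Finset.mem_univ j)
  -- the valuations of the terms are distinct modulo the degree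
  intro i _ l _ hil hi h
  have hi0 : a i ≠ 0 := by rintro h0; simp [h0] at hi
  have hl0 : a l ≠ 0 := by
    rintro h0
    rw [h0, map_zero, zero_mul, ord_zero, ord_eq_top_iff] at h
    exact hi h
  obtain ⟨m, hm⟩ := exists_ord_eq hi0
  obtain ⟨m', hm'⟩ := exists_ord_eq hl0
  rw [ord_algebraMap_mul_pow hram hπ hm, ord_algebraMap_mul_pow hram hπ hm', WithTop.coe_inj] at h
  have h2 := congrArg (· % (Module.finrank K L : ℤ)) h
  simp only [Int.mul_add_emod_self_left] at h2
  rw [Int.emod_eq_of_lt (by omega) (by exact_mod_cast i.2),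
    Int.emod_eq_of_lt (by omega) (by exact_mod_cast l.2)] at h2
  exact hil (Fin.ext (by exact_mod_cast h2))

variable [FiniteDimensional K L]

/-- The powers of a uniformizer form a basis of a totally ramified extension, and each term of the
expansion of `y` has at least the valuation of `y`. -/
theorem exists_expansion (hram : IsTotallyRamified K L) {π : L}
    (hπ : ord π = ((1 : ℤ) : WithTop ℤ)) (y : L) :
    ∃ a : Fin (Module.finrank K L) → K, y = ∑ i, algebraMap K L (a i) * π ^ (i : ℕ) ∧
      ∀ i, ord y ≤ ord (algebraMap K L (a i) * π ^ (i : ℕ)) := by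
  have hli : LinearIndependent K (fun i : Fin (Module.finrank K L) => π ^ (i : ℕ)) := by
    rw [Fintype.linearIndependent_iff]
    intro g hg i
    have h := ord_sum_mul_pow_le hram hπ g i
    simp only [Algebra.smul_def] at hg
    rw [hg, ord_zero, top_le_iff, ord_eq_top_iff, mul_eq_zero] at h
    rcases h with h | h
    · simpa using h
    · exact absurd h (pow_ne_zero _ (ne_zero_of_ord hπ))
  have hspan := hli.span_eq_top_of_card_eq_finrank' (by simp)
  have hy : y ∈ Submodule.span K (Set.range fun i : Fin (Module.finrank K L) => π ^ (i : ℕ)) := by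
    rw [hspan]; trivial
  rw [Submodule.mem_span_range_iff_exists_fun] at hy
  obtain ⟨a, ha⟩ := hy
  simp only [Algebra.smul_def] at ha
  exact ⟨a, ha.symm, fun i => by rw [← ha]; exact ord_sum_mul_pow_le hram hπ a i⟩

theorem exists_integral_expansion (hram : IsTotallyRamified K L) {π : L}
    (hπ : ord π = ((1 : ℤ) : WithTop ℤ)) (y : L) (hy : 0 ≤ ord y) :
    ∃ a : Fin (Module.finrank K L) → K, y = ∑ i, algebraMap K L (a i) * π ^ (i : ℕ) ∧
      ∀ i, 0 ≤ ord (a i) := by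
  obtain ⟨a, ha, h⟩ := exists_expansion hram hπ y
  refine ⟨a, ha, fun i => ?_⟩
  rcases eq_or_ne (a i) 0 with h0 | h0
  · simp [h0, ord_zero]
  obtain ⟨m, hm⟩ := exists_ord_eq h0
  have h1 := hy.trans (h i)
  rw [ord_algebraMap_mul_pow hram hπ hm] at h1
  rw [hm]
  norm_cast at h1 ⊢
  by_contra hneg
  have h2 := i.2
  have h3 : (Module.finrank K L : ℤ) * m ≤ Module.finrank K L * (-1) :=
    mul_le_mul_of_nonneg_left (by omega) (by omega)
  omega

/-- The residue field does not grow in a totally ramified extension. -/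
theorem exists_algebraMap_sub_ord_pos (p : ℕ) [Fact p.Prime] [CharP K p] [CompleteSpace K]
    [PerfectField 𝓀[K]] (hram : IsTotallyRamified K L) {π : L}
    (hπ : ord π = ((1 : ℤ) : WithTop ℤ)) (y : L) (hy : 0 ≤ ord y) :
    ∃ c : coeffField p K, 0 < ord (y - algebraMap K L c) := by
  have hN : 0 < Module.finrank K L := Module.finrank_pos
  obtain ⟨a, ha, h⟩ := exists_integral_expansion hram hπ y hy
  obtain ⟨c, hc⟩ := exists_coeffField_sub_ord_pos p (a ⟨0, hN⟩) (h _)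
  refine ⟨c, ?_⟩
  have h1 : algebraMap K L c =
      ∑ i : Fin (Module.finrank K L), if i = ⟨0, hN⟩ then algebraMap K L c else 0 := by simp
  rw [ha, h1, ← Finset.sum_sub_distrib]
  refine (ordVal L).map_lt_sum' (WithTop.coe_lt_top 0) fun i _ => ?_
  rw [ordVal_apply]
  split_ifs with hi
  · subst hi
    rw [pow_zero, mul_one, ← map_sub]
    rcases eq_or_ne (a ⟨0, hN⟩ - c) 0 with h0 | h0
    · rw [h0, map_zero, ord_zero]; exact WithTop.coe_lt_top 0
    obtain ⟨m, hm⟩ := exists_ord_eq h0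
    rw [ord_algebraMap hram hm]
    rw [hm] at hc
    norm_cast at hc ⊢
    positivity
  · rw [sub_zero, ord_mul]
    refine lt_of_lt_of_le ?_ (le_add_of_nonneg_left (zero_le_ord_algebraMap hram (h i)))
    rw [ord_pow_uniformizer hπ]
    have : (i : ℕ) ≠ 0 := fun h => hi (Fin.ext h)
    norm_cast
    omega

/-- Galois automorphisms preserve integrality: a uniformizer satisfies a monic equation of degree
`[L : K]` with integral coefficients in `K`. -/
theorem zero_le_ord_galois (hram : IsTotallyRamified K L) {π : L}
    (hπ : ord π = ((1 : ℤ) : WithTop ℤ)) (σ : Gal(L/K)) (y : L) (hy : 0 ≤ ord y) :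
    0 ≤ ord (σ y) := by
  have hN : 0 < Module.finrank K L := Module.finrank_pos
  have key : 0 ≤ ord (σ π) := by
    -- `σ π` is integral over the valuation ring of `K`
    obtain ⟨a, ha, h⟩ := exists_integral_expansion hram hπ (π ^ Module.finrank K L)
      (by rw [ord_pow_uniformizer hπ]; norm_cast; omega)
    obtain ⟨w, hw⟩ := exists_ord_eq (x := σ π) (by simpa using ne_zero_of_ord hπ)
    have h1 := congrArg σ ha
    simp only [map_pow, map_sum, map_mul, AlgEquiv.commutes] at h1
    by_contra hneg
    rw [hw] at hneg
    norm_cast at hneg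
    have h2 : (((Module.finrank K L - 1 : ℤ) * w : ℤ) : WithTop ℤ) ≤
        ord (σ π ^ Module.finrank K L) := by
      rw [h1]
      refine le_ord_sum fun i _ => ?_
      rw [ord_mul, ord_pow, hw, ← WithTop.coe_nsmul]
      refine le_trans ?_ (add_le_add_left (zero_le_ord_algebraMap hram (h i)) _)
      rw [zero_add, WithTop.coe_le_coe, nsmul_eq_mul]
      have := i.2
      refine mul_le_mul_of_nonpos_right ?_ (by omega)
      omega
    rw [ord_pow, hw, ← WithTop.coe_nsmul, WithTop.coe_le_coe, nsmul_eq_mul] at h2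
    have h3 : ((Module.finrank K L : ℤ) - 1) * w = Module.finrank K L * w - w := by ring
    rw [h3] at h2
    omega
  obtain ⟨a, ha, h⟩ := exists_integral_expansion hram hπ y hy
  rw [ha, map_sum]
  refine le_ord_sum fun i _ => ?_
  rw [map_mul, AlgEquiv.commutes, map_pow, ord_mul, ord_pow]
  exact add_nonneg (zero_le_ord_algebraMap hram (h i)) (nsmul_nonneg key _)

/-- Galois automorphisms of a totally ramified extension are isometries. -/
theorem ord_galois (hK : Function.Surjective (Valued.v : Valuation K ℤᵐ⁰))
    (hram : IsTotallyRamified K L) {π : L} (hπ : ord π = ((1 : ℤ) : WithTop ℤ))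
    (σ : Gal(L/K)) (y : L) : ord (σ y) = ord y := by
  have hN : 0 < Module.finrank K L := Module.finrank_pos
  have key : ∀ (σ : Gal(L/K)) (y : L), ord y ≤ ord (σ y) := by
    intro σ y
    rcases eq_or_ne y 0 with rfl | h0
    · simp
    obtain ⟨m, hm⟩ := exists_ord_eq h0
    obtain ⟨l, hl⟩ := exists_ord_eq (x := σ y) (by simpa using h0)
    obtain ⟨t, ht⟩ := exists_ord hK (-m)
    -- `y ^ N` and a suitable element of `K` differ by a unit
    have h1 : 0 ≤ ord (algebraMap K L t * y ^ Module.finrank K L) := by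
      rw [ord_mul, ord_algebraMap hram ht, ord_pow, hm, ← WithTop.coe_nsmul, nsmul_eq_mul,
        ← WithTop.coe_add]
      refine le_of_eq ?_
      rw [← WithTop.coe_zero, WithTop.coe_inj]
      ring
    have h2 := zero_le_ord_galois hram hπ σ _ h1
    rw [map_mul, AlgEquiv.commutes, map_pow, ord_mul, ord_algebraMap hram ht, ord_pow, hl,
      ← WithTop.coe_nsmul, nsmul_eq_mul, ← WithTop.coe_add, ← WithTop.coe_zero,
      WithTop.coe_le_coe] at h2
    rw [hm, hl, WithTop.coe_le_coe]
    have h3 : 0 ≤ (Module.finrank K L : ℤ) * (l - m) := by linarith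
    have := nonneg_of_mul_nonneg_right h3 (by exact_mod_cast hN)
    omega
  refine le_antisymm ?_ (key σ y)
  have := key σ⁻¹ (σ y)
  rwa [← AlgEquiv.mul_apply, inv_mul_cancel, AlgEquiv.one_apply] at this

end Extension

/-! ### Ramification groups with a single break -/

section Integral

variable {L : Type*} [Field L] [Valued L ℤᵐ⁰]

theorem ord_sub_le_ord_pow_sub_pow {x y : L} (hx : 0 ≤ ord x) (hy : 0 ≤ ord y) (i : ℕ) :
    ord (x - y) ≤ ord (x ^ i - y ^ i) := by
  induction i with
  | zero => simp [ord_zero]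
  | succ i ih =>
    have : x ^ (i + 1) - y ^ (i + 1) = x ^ i * (x - y) + (x ^ i - y ^ i) * y := by ring
    rw [this]
    refine le_ord_add ?_ ?_
    · rw [ord_mul, ord_pow]
      exact le_add_of_nonneg_left (nsmul_nonneg hx i)
    · rw [ord_mul]
      exact ih.trans (le_add_of_nonneg_right hy)

/-- If an integral polynomial vanishes at distinct integral points, then its value at an integral
point `x` is divisible by the product of the differences of `x` and these points. -/
theorem sum_ord_sub_le_ord_eval {ι : Type*} (s : Finset ι) (f : ι → 𝒪[L])
    (hf : Set.InjOn f s) (P : 𝒪[L][X]) (hP : ∀ i ∈ s, P.eval (f i) = 0) (x : 𝒪[L]) :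
    ∑ i ∈ s, ord ((x : L) - f i) ≤ ord ((P.eval x : 𝒪[L]) : L) := by
  have h1 : ∏ i ∈ s, (X - C (f i)) ∣ P := by
    rcases eq_or_ne P 0 with rfl | h0
    · exact dvd_zero _
    have h2 : (s.val.map f) ≤ P.roots := by
      rw [Multiset.le_iff_subset (Multiset.Nodup.map_on (fun a ha b hb h => hf ha hb h) s.nodup)]
      intro a ha
      obtain ⟨i, hi, rfl⟩ := Multiset.mem_map.1 ha
      exact (mem_roots h0).2 (hP i hi)
    have h3 := (Multiset.prod_X_sub_C_dvd_iff_le_roots h0 _).2 h2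
    rwa [Multiset.map_map] at h3
  obtain ⟨Q, hQ⟩ := h1
  have h4 : ((P.eval x : 𝒪[L]) : L) = (∏ i ∈ s, ((x : L) - f i)) * ((Q.eval x : 𝒪[L]) : L) := by
    rw [hQ, eval_mul, eval_prod]
    simp
  rw [h4, ord_mul, ord_prod]
  exact le_add_of_nonneg_right (zero_le_ord_iff.2 (Q.eval x).2)

end Integral

section Break

theorem eq_one_of_mem_lowerRamification {K L : Type*} [Field K] [Field L] [Valued L ℤᵐ⁰]
    [Algebra K L] {b : ℕ} (hbreak : lowerBreaks K L = {(b : ℤ)}) {σ : Gal(L/K)}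
    (hσ : σ ∈ lowerRamification K L (b + 1)) : σ = 1 := by
  have key : ∀ j : ℕ, σ ∈ lowerRamification K L (b + 1 + j) := by
    intro j
    induction j with
    | zero => simpa using hσ
    | succ j ih =>
      have h1 : ((b : ℤ) + 1 + j) ∉ lowerBreaks K L := by
        rw [hbreak, Set.mem_singleton_iff]
        omega
      have h2 : lowerRamification K L ((b : ℤ) + 1 + j) =
          lowerRamification K L ((b : ℤ) + 1 + j + 1) := by
        by_contra h
        exact h1 ⟨by omega, h⟩
      rw [h2] at ih
      convert ih using 2
      push_cast
      ring
  have h0 : ∀ x : L, 0 ≤ ord x → σ x = x := by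
    intro x hx
    by_contra hne
    obtain ⟨m, hm⟩ := exists_ord_eq (sub_ne_zero.2 hne)
    have h1 := key m.toNat x hx
    rw [hm, WithTop.coe_le_coe] at h1
    omega
  ext x
  rcases le_total 0 (ord x) with hx | hx
  · exact h0 x hx
  · rcases eq_or_ne x 0 with rfl | hx0
    · simp
    obtain ⟨m, hm⟩ := exists_ord_eq hx0
    have h1 := h0 x⁻¹ (by
      rw [ord_inv hm]
      rw [hm] at hx
      norm_cast at hx ⊢
      omega)
    rw [map_inv₀] at h1
    exact inv_injective h1

variable {K L : Type*} [Field K] [Valued K ℤᵐ⁰] [Field L] [Valued L ℤᵐ⁰] [Algebra K L]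
  [FiniteDimensional K L] {π : L} {b : ℕ}

theorem lowerRamification_eq_univ (hK : Function.Surjective (Valued.v : Valuation K ℤᵐ⁰))
    (hram : IsTotallyRamified K L) (hπ : ord π = ((1 : ℤ) : WithTop ℤ))
    (hbreak : lowerBreaks K L = {(b : ℤ)}) : lowerRamification K L b = Set.univ := by
  have key : ∀ j : ℕ, j ≤ b + 1 → lowerRamification K L ((j : ℤ) - 1) = Set.univ := by
    intro j
    induction j with
    | zero =>
      intro _
      refine Set.eq_univ_of_forall fun σ x hx => ?_
      simpa using le_ord_sub (by rwa [ord_galois hK hram hπ]) hx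
    | succ j ih =>
      intro hj
      have h1 : ((j : ℤ) - 1) ∉ lowerBreaks K L := by
        rw [hbreak, Set.mem_singleton_iff]
        omega
      have h2 : lowerRamification K L ((j : ℤ) - 1) = lowerRamification K L ((j : ℤ) - 1 + 1) := by
        by_contra h
        exact h1 ⟨by omega, h⟩
      rw [← ih (by omega), h2]
      congr 1
      push_cast
      ring
  have := key (b + 1) le_rfl
  rwa [Nat.cast_succ, add_sub_cancel_right] at this

theorem le_ord_galois_sub (hK : Function.Surjective (Valued.v : Valuation K ℤᵐ⁰))
    (hram : IsTotallyRamified K L) (hπ : ord π = ((1 : ℤ) : WithTop ℤ))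
    (hbreak : lowerBreaks K L = {(b : ℤ)}) (σ : Gal(L/K)) (x : L) (hx : 0 ≤ ord x) :
    ((b + 1 : ℤ) : WithTop ℤ) ≤ ord (σ x - x) := by
  have h : σ ∈ lowerRamification K L b := by
    rw [lowerRamification_eq_univ hK hram hπ hbreak]; trivial
  exact h x hx

theorem ord_galois_sub_uniformizer (hK : Function.Surjective (Valued.v : Valuation K ℤᵐ⁰))
    (hram : IsTotallyRamified K L) (hπ : ord π = ((1 : ℤ) : WithTop ℤ))
    (hbreak : lowerBreaks K L = {(b : ℤ)}) {σ : Gal(L/K)} (hσ : σ ≠ 1) :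
    ord (σ π - π) = ((b + 1 : ℤ) : WithTop ℤ) := by
  have hπ0 : 0 ≤ ord π := by rw [hπ]; norm_cast
  refine le_antisymm ?_ (le_ord_galois_sub hK hram hπ hbreak σ π hπ0)
  by_contra hlt
  rw [not_le, ← coe_add_one_le_iff] at hlt
  refine hσ (eq_one_of_mem_lowerRamification hbreak fun x hx => hlt.trans ?_)
  obtain ⟨a, ha, h⟩ := exists_integral_expansion hram hπ x hx
  rw [ha, map_sum, ← Finset.sum_sub_distrib]
  refine le_ord_sum fun i _ => ?_
  rw [map_mul, AlgEquiv.commutes, map_pow, ← mul_sub, ord_mul]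
  refine (ord_sub_le_ord_pow_sub_pow ?_ hπ0 i).trans
    (le_add_of_nonneg_left (zero_le_ord_algebraMap hram (h i)))
  rwa [ord_galois hK hram hπ]

theorem galois_uniformizer_injective (hK : Function.Surjective (Valued.v : Valuation K ℤᵐ⁰))
    (hram : IsTotallyRamified K L) (hπ : ord π = ((1 : ℤ) : WithTop ℤ))
    (hbreak : lowerBreaks K L = {(b : ℤ)}) :
    Function.Injective (fun σ : Gal(L/K) => σ π) := by
  intro σ τ h
  by_contra hne
  have h1 : σ⁻¹ * τ ≠ 1 := fun h' => hne (inv_mul_eq_one.1 h')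
  have h2 := ord_galois_sub_uniformizer hK hram hπ hbreak h1
  have h3 : (σ⁻¹ * τ) π = π := by
    rw [AlgEquiv.mul_apply]
    rw [← show σ π = τ π from h, ← AlgEquiv.mul_apply, inv_mul_cancel, AlgEquiv.one_apply]
  rw [h3, sub_self, ord_zero] at h2
  exact WithTop.top_ne_coe h2

/-- The displacement of an integral element of the fixed field of `H`: writing `y = g(π)` with `g`
integral over `K`, the polynomial `g - σ(y)` vanishes at `σ τ π` for all `τ ∈ H`, so its value
`y - σ(y)` at `π` is divisible by `∏ (π - σ τ π)`. -/
theorem le_ord_galois_sub_of_fixed_integral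
    (hK : Function.Surjective (Valued.v : Valuation K ℤᵐ⁰))
    (hram : IsTotallyRamified K L) (hπ : ord π = ((1 : ℤ) : WithTop ℤ))
    (hbreak : lowerBreaks K L = {(b : ℤ)}) (H : Subgroup Gal(L/K)) {y : L} (hy : 0 ≤ ord y)
    (hfix : ∀ τ ∈ H, τ y = y) (σ : Gal(L/K)) :
    ((Nat.card H * (b + 1) : ℤ) : WithTop ℤ) ≤ ord (σ y - y) := by
  have hπ0 : 0 ≤ ord π := by rw [hπ]; norm_cast
  have hi : ∀ (τ : Gal(L/K)) {x : L}, 0 ≤ ord x → Valued.v (τ x) ≤ 1 := fun τ x hx =>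
    zero_le_ord_iff.1 (by rwa [ord_galois hK hram hπ])
  have := Fintype.ofFinite H
  obtain ⟨a, ha, h⟩ := exists_integral_expansion hram hπ y hy
  let g : 𝒪[L][X] := ∑ i, C (⟨algebraMap K L (a i),
    zero_le_ord_iff.1 (zero_le_ord_algebraMap hram (h i))⟩ : 𝒪[L]) * X ^ (i : ℕ)
  let f : H → 𝒪[L] := fun τ => ⟨(σ * τ) π, hi _ hπ0⟩
  let P : 𝒪[L][X] := g - C ⟨σ y, hi σ hy⟩
  have hg : ∀ z : 𝒪[L],
      ((g.eval z : 𝒪[L]) : L) = ∑ i, algebraMap K L (a i) * (z : L) ^ (i : ℕ) := by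
    intro z
    simp [g, eval_finsetSum]
  have hgτ : ∀ τ : Gal(L/K), ∑ i, algebraMap K L (a i) * (τ π) ^ (i : ℕ) = τ y := by
    intro τ
    conv_rhs => rw [ha]
    simp [map_sum]
  have h1 := sum_ord_sub_le_ord_eval Finset.univ f (fun τ _ τ' _ hτ => by
      have h2 := galois_uniformizer_injective hK hram hπ hbreak (congrArg Subtype.val hτ)
      exact Subtype.ext (mul_left_cancel h2)) P (fun τ _ => by
      apply Subtype.ext
      have h2 : (((P.eval (f τ) : 𝒪[L])) : L) = (σ * τ) y - σ y := by
        simp only [P, eval_sub, eval_C, AddSubgroupClass.coe_sub, hg]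
        rw [← hgτ (σ * τ)]
      rw [h2, AlgEquiv.mul_apply, hfix τ τ.2, sub_self]
      rfl) ⟨π, zero_le_ord_iff.1 hπ0⟩
  have h3 : ((P.eval ⟨π, zero_le_ord_iff.1 hπ0⟩ : 𝒪[L]) : L) = y - σ y := by
    simp only [P, eval_sub, eval_C, AddSubgroupClass.coe_sub, hg]
    rw [← ha]
  rw [h3, ord_sub_swap] at h1
  refine le_trans ?_ h1
  have h4 : ∀ τ ∈ (Finset.univ : Finset H),
      ((b + 1 : ℤ) : WithTop ℤ) ≤ ord (π - (f τ : L)) := fun τ _ => by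
    rw [ord_sub_swap]
    exact le_ord_galois_sub hK hram hπ hbreak _ π hπ0
  refine le_trans (le_of_eq ?_) (Finset.card_nsmul_le_sum _ _ _ h4)
  rw [← WithTop.coe_nsmul, Finset.card_univ, Nat.card_eq_fintype_card]
  simp

end Break

/-! ### Displacement of the elements of fixed fields -/

section Displacement

variable {K L : Type*} [Field K] [Field L] [Valued L ℤᵐ⁰] [Algebra K L]

/-- The group of elements `x` of `Lˣ` with `v(σ x - x) ≥ v(x) + B`. -/
def displacementGroup (hord : ∀ (σ : Gal(L/K)) (y : L), ord (σ y) = ord y) (σ : Gal(L/K))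
    (B : WithTop ℤ) : Subgroup Lˣ where
  carrier := {x | B ≤ ord (σ x / x - 1 : L)}
  one_mem' := by simp [ord_zero]
  mul_mem' := fun {x y} hx hy => by
    have h0 : ord (σ y / y : L) = 0 := by
      obtain ⟨m, hm⟩ := exists_ord_eq y.ne_zero
      rw [div_eq_mul_inv, ord_mul, hord, hm, ord_inv hm, ← WithTop.coe_add, add_neg_cancel]
      rfl
    have h : (σ (x * y : L) / (x * y : L) - 1 : L) =
        (σ x / x - 1) * (σ y / y) + (σ y / y - 1) := by
      have hx0 := x.ne_zero
      have hy0 := y.ne_zero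
      rw [map_mul]
      field_simp
      ring
    rw [Set.mem_ofPred_eq] at hx hy ⊢
    rw [Units.val_mul, h]
    refine le_ord_add ?_ hy
    rwa [ord_mul, h0, add_zero]
  inv_mem' := fun {x} hx => by
    have h0 : ord (x / σ x : L) = 0 := by
      obtain ⟨m, hm⟩ := exists_ord_eq x.ne_zero
      rw [div_eq_mul_inv, ord_mul, ord_inv ((hord σ x).trans hm), hm, ← WithTop.coe_add,
        add_neg_cancel]
      rfl
    have h : (σ (x⁻¹ : L) / (x⁻¹ : L) - 1 : L) = -((σ x / x - 1) * (x / σ x)) := by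
      have hx0 := x.ne_zero
      have hx1 : σ (x : L) ≠ 0 := by simp
      rw [map_inv₀]
      field_simp
      ring
    rw [Set.mem_ofPred_eq] at hx ⊢
    rw [Units.val_inv_eq_inv_val, h, ord_neg, ord_mul, h0, add_zero]
    exact hx

theorem mem_displacementGroup_iff (hord : ∀ (σ : Gal(L/K)) (y : L), ord (σ y) = ord y)
    (σ : Gal(L/K)) (B : ℤ) (x : Lˣ) {m : ℤ} (hx : ord (x : L) = m) :
    x ∈ displacementGroup hord σ B ↔ ((m + B : ℤ) : WithTop ℤ) ≤ ord (σ x - x : L) := by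
  have h : (σ x / x - 1 : L) = (σ x - x) * (x : L)⁻¹ := by
    have hx0 := x.ne_zero
    field_simp
  change (B : WithTop ℤ) ≤ ord (σ x / x - 1 : L) ↔ _
  rw [h, ord_mul, ord_inv hx]
  generalize ord (σ x - x : L) = u
  induction u with
  | top => simp
  | coe u => norm_cast; omega

end Displacement

section FixedField

variable {K L : Type*} [Field K] [Valued K ℤᵐ⁰] [Field L] [Valued L ℤᵐ⁰] [Algebra K L]
  [FiniteDimensional K L] [IsGalois K L] {π : L} {b : ℕ}

/-- The valuation of an element of the fixed field of `H` is divisible by the order of `H`, since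
the product of its conjugates lies in `K`. -/
theorem card_dvd_ord_of_fixed (hK : Function.Surjective (Valued.v : Valuation K ℤᵐ⁰))
    (hram : IsTotallyRamified K L) (hπ : ord π = ((1 : ℤ) : WithTop ℤ)) (H : Subgroup Gal(L/K))
    {y : L} {m : ℤ} (hy : ord y = m) (hfix : ∀ τ ∈ H, τ y = y) : (Nat.card H : ℤ) ∣ m := by
  have := Fintype.ofFinite (Gal(L/K) ⧸ H)
  have hy0 := ne_zero_of_ord hy
  let φ : Gal(L/K) ⧸ H → L := fun q => q.out y
  have hφ : ∀ (σ : Gal(L/K)) (q : Gal(L/K) ⧸ H), σ (φ q) = φ (σ • q) := by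
    intro σ q
    obtain ⟨h, hh⟩ := QuotientGroup.mk_out_eq_mul H (σ * q.out)
    have h2 : ((σ * q.out : Gal(L/K)) : Gal(L/K) ⧸ H) = σ • q := by
      conv_rhs => rw [← QuotientGroup.out_eq' q]
      rfl
    rw [h2] at hh
    change σ (q.out y) = (σ • q).out y
    rw [hh, AlgEquiv.mul_apply, hfix h h.2, AlgEquiv.mul_apply]
  have hz : ∀ σ : Gal(L/K), σ (∏ q, φ q) = ∏ q, φ q := by
    intro σ
    rw [map_prod]
    simp only [hφ]
    exact Fintype.prod_equiv (MulAction.toPerm σ) _ _ fun q => rfl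
  obtain ⟨t, ht⟩ := (IsGalois.mem_range_algebraMap_iff_fixed _).2 hz
  have ht0 : t ≠ 0 := by
    rintro rfl
    rw [map_zero] at ht
    exact Finset.prod_ne_zero_iff.2 (fun q _ => by simp [φ, hy0]) ht.symm
  obtain ⟨l, hl⟩ := exists_ord_eq ht0
  have h1 := ord_algebraMap hram hl
  rw [ht, ord_prod, Finset.sum_congr rfl fun q _ => (ord_galois hK hram hπ q.out y).trans hy,
    Finset.sum_const, ← WithTop.coe_nsmul, WithTop.coe_inj, ← IsGalois.card_aut_eq_finrank,
    Subgroup.card_eq_card_quotient_mul_card_subgroup H, Finset.card_univ,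
    Nat.card_eq_fintype_card] at h1
  have h2 : ((Fintype.card (Gal(L/K) ⧸ H) : ℕ) : ℤ) ≠ 0 := by
    exact_mod_cast Fintype.card_ne_zero
  refine ⟨l, mul_left_cancel₀ h2 ?_⟩
  rw [nsmul_eq_mul] at h1
  push_cast at h1
  rw [h1, mul_assoc]

/-- Elements of `Gal(L/K)` move the elements of the fixed field of `H` by at least `b |H|`: this is
the single lower break `b` of the fixed field over `K`, measured by the valuation of `L`. -/
theorem le_ord_galois_sub_of_fixed (hK : Function.Surjective (Valued.v : Valuation K ℤᵐ⁰))
    (hram : IsTotallyRamified K L) (hπ : ord π = ((1 : ℤ) : WithTop ℤ))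
    (hbreak : lowerBreaks K L = {(b : ℤ)}) (H : Subgroup Gal(L/K)) {y : L}
    (hfix : ∀ τ ∈ H, τ y = y) (σ : Gal(L/K)) {m : ℤ} (hm : (m : WithTop ℤ) ≤ ord y) :
    ((m + b * Nat.card H : ℤ) : WithTop ℤ) ≤ ord (σ y - y) := by
  rcases eq_or_ne y 0 with rfl | hy0
  · simp [ord_zero]
  obtain ⟨m', hm'⟩ := exists_ord_eq hy0
  rw [hm', WithTop.coe_le_coe] at hm
  refine le_trans (b := ((m' + b * Nat.card H : ℤ) : WithTop ℤ)) (by norm_cast; omega) ?_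
  clear hm
  have hord := fun (σ : Gal(L/K)) (y : L) => ord_galois hK hram hπ σ y
  have := Fintype.ofFinite H
  -- a uniformizer of the fixed field
  let ϖ : L := ∏ τ : H, (τ : Gal(L/K)) π
  have hϖ : ord ϖ = ((Nat.card H : ℤ) : WithTop ℤ) := by
    rw [ord_prod, Finset.sum_congr rfl fun (τ : H) _ => (hord τ π).trans hπ, Finset.sum_const,
      Finset.card_univ, ← WithTop.coe_nsmul, Nat.card_eq_fintype_card]
    simp
  have hϖfix : ∀ τ ∈ H, τ ϖ = ϖ := by
    intro τ hτ
    rw [map_prod]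
    refine Fintype.prod_equiv (Equiv.mulLeft (⟨τ, hτ⟩ : H)) _ _ fun τ' => ?_
    rfl
  obtain ⟨k, hk⟩ := card_dvd_ord_of_fixed hK hram hπ H hm' hfix
  have hϖ0 := ne_zero_of_ord hϖ
  let ϖu : Lˣ := Units.mk0 ϖ hϖ0
  let yu : Lˣ := Units.mk0 y hy0
  let B : ℤ := Nat.card H * b
  have hu0 : ord ((yu * (ϖu ^ k)⁻¹ : Lˣ) : L) = ((0 : ℤ) : WithTop ℤ) := by
    have h1 : ((yu * (ϖu ^ k)⁻¹ : Lˣ) : L) = y * ϖ ^ (-k) := by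
      simp [yu, ϖu]
    rw [h1, ord_mul, hm', ord_zpow hϖ, ← WithTop.coe_add, hk]
    congr 1
    ring
  have h1 : ϖu ∈ displacementGroup hord σ B := by
    rw [mem_displacementGroup_iff hord σ B ϖu hϖ]
    refine le_trans (le_of_eq ?_) (le_ord_galois_sub_of_fixed_integral hK hram hπ hbreak H
      (y := ϖ) (by rw [hϖ]; norm_cast; omega) hϖfix σ)
    congr 1
    simp only [B]
    ring
  have h2 : yu * (ϖu ^ k)⁻¹ ∈ displacementGroup hord σ B := by
    rw [mem_displacementGroup_iff hord σ B _ hu0]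
    refine le_trans ?_ (le_ord_galois_sub_of_fixed_integral hK hram hπ hbreak H
      (y := ((yu * (ϖu ^ k)⁻¹ : Lˣ) : L)) (by rw [hu0]; rfl) (fun τ hτ => ?_) σ)
    · rw [WithTop.coe_le_coe]
      simp only [B]
      nlinarith
    · simp only [Units.val_mul, Units.val_inv_eq_inv_val, Units.val_zpow_eq_zpow_val, map_mul,
        map_inv₀, map_zpow₀, yu, ϖu, Units.val_mk0, hfix τ hτ, hϖfix τ hτ]
  have h3 : yu ∈ displacementGroup hord σ B := by
    have := mul_mem h2 (zpow_mem h1 k)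
    rwa [inv_mul_cancel_right] at this
  rw [mem_displacementGroup_iff hord σ B yu hm'] at h3
  simpa [B, yu, mul_comm] using h3

end FixedField

/-! ### Elements with smallest possible trace -/

section Trace

variable {K L : Type*} [Field K] [Valued K ℤᵐ⁰] [Field L] [Valued L ℤᵐ⁰] [Algebra K L]
  [FiniteDimensional K L] [IsGalois K L] {π : L} {b : ℕ}

/-- An element of trace `1`, of the valuation dictated by the different. -/
theorem exists_trace_eq_one (hK : Function.Surjective (Valued.v : Valuation K ℤᵐ⁰))
    (hram : IsTotallyRamified K L) (hπ : ord π = ((1 : ℤ) : WithTop ℤ))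
    (hbreak : lowerBreaks K L = {(b : ℤ)}) :
    ∃ x : L, ∑ σ : Gal(L/K), σ x = 1 ∧
      ord x = ((-(b * (Module.finrank K L - 1)) : ℤ) : WithTop ℤ) := by
  classical
  have hN : Fintype.card Gal(L/K) = Module.finrank K L := by
    rw [← Nat.card_eq_fintype_card, IsGalois.card_aut_eq_finrank]
  have hN0 : 0 < Module.finrank K L := Module.finrank_pos
  -- Euler's formula `Tr (π ^ (N - 1) / f'(π)) = 1` for the minimal polynomial `f` of `π`
  let x : L := π ^ (Module.finrank K L - 1) / ∏ τ ∈ Finset.univ.erase (1 : Gal(L/K)), (π - τ π)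
  refine ⟨x, ?_, ?_⟩
  · have h1 := Lagrange.leadingCoeff_eq_sum (s := (Finset.univ : Finset Gal(L/K)))
      (v := fun σ => σ π) (P := (X : L[X]) ^ (Module.finrank K L - 1))
      ((galois_uniformizer_injective hK hram hπ hbreak).injOn) (by
        rw [degree_X_pow, Finset.card_univ, hN]
        norm_cast
        omega)
    rw [(monic_X_pow _).leadingCoeff] at h1
    rw [h1]
    refine Finset.sum_congr rfl fun σ _ => ?_
    simp only [x, map_div₀, map_pow, map_prod, map_sub, eval_pow, eval_X]
    congr 1
    refine Finset.prod_bij (fun τ _ => σ * τ) ?_ ?_ ?_ ?_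
    · intro τ hτ
      simpa using hτ
    · intro τ _ τ' _ h
      exact mul_left_cancel h
    · intro τ hτ
      exact ⟨σ⁻¹ * τ, by simpa [inv_mul_eq_one, eq_comm] using hτ, by simp⟩
    · intro τ _
      rfl
  · have h1 : ord (∏ τ ∈ Finset.univ.erase (1 : Gal(L/K)), (π - τ π)) =
        (((Module.finrank K L - 1 : ℕ) * (b + 1) : ℤ) : WithTop ℤ) := by
      rw [ord_prod, Finset.sum_congr rfl fun τ hτ => (ord_sub_swap π (τ π)).trans
        (ord_galois_sub_uniformizer hK hram hπ hbreak (Finset.ne_of_mem_erase hτ)),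
        Finset.sum_const, Finset.card_erase_of_mem (Finset.mem_univ _), Finset.card_univ, hN,
        ← WithTop.coe_nsmul, nsmul_eq_mul]
    change ord (_ / _) = _
    rw [div_eq_mul_inv, ord_mul, ord_inv h1, ord_pow_uniformizer hπ, ← WithTop.coe_add]
    congr 1
    push_cast [Nat.cast_sub (show 1 ≤ Module.finrank K L from hN0)]
    ring

/-- The trace of an element of valuation congruent to `b` has the least possible valuation. The
lower bound `htr` for traces is a hypothesis here; it is supplied by `le_ord_trace`. -/
theorem ord_trace_of_modEq (p : ℕ) [Fact p.Prime] [CharP K p] [CompleteSpace K]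
    [PerfectField 𝓀[K]] (hK : Function.Surjective (Valued.v : Valuation K ℤᵐ⁰))
    (hram : IsTotallyRamified K L) (hπ : ord π = ((1 : ℤ) : WithTop ℤ))
    (hbreak : lowerBreaks K L = {(b : ℤ)})
    (htr : ∀ (y : L) (m : ℤ), (m : WithTop ℤ) ≤ ord y →
      ((m + b * (Module.finrank K L - 1) : ℤ) : WithTop ℤ) ≤ ord (∑ σ : Gal(L/K), σ y))
    {ρ : L} {m : ℤ} (hρ : ord ρ = m) (hm : m ≡ b [ZMOD (Module.finrank K L : ℤ)]) :
    ord (∑ σ : Gal(L/K), σ ρ) = ((m + b * (Module.finrank K L - 1) : ℤ) : WithTop ℤ) := by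
  obtain ⟨x, hx, hxord⟩ := exists_trace_eq_one hK hram hπ hbreak
  obtain ⟨t, ht⟩ := hm.symm.dvd
  -- `ρ` agrees with a `K`-multiple of `x` up to terms of higher valuation
  obtain ⟨c, hc⟩ := exists_ord hK (t + b)
  have hcx : ord (algebraMap K L c * x) = m := by
    rw [ord_mul, ord_algebraMap hram hc, hxord, ← WithTop.coe_add]
    congr 1
    linear_combination -ht
  have hcx0 := ne_zero_of_ord hcx
  have hq : ord (ρ * (algebraMap K L c * x)⁻¹) = 0 := by
    rw [ord_mul, hρ, ord_inv hcx, ← WithTop.coe_add, add_neg_cancel]; rfl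
  obtain ⟨d, hd⟩ := exists_algebraMap_sub_ord_pos p hram hπ _ hq.ge
  have hd0 : d ≠ 0 := by
    rintro rfl
    rw [ZeroMemClass.coe_zero, map_zero, sub_zero, hq] at hd
    exact lt_irrefl _ hd
  have hdc : ord ((d : K) * c) = ((t + b : ℤ) : WithTop ℤ) := by
    rw [ord_mul, ord_coeffField p d hd0, zero_add, hc]
  set ρ' := ρ - algebraMap K L (d * c) * x with hρ'
  have h1 : ((m + 1 : ℤ) : WithTop ℤ) ≤ ord ρ' := by
    have h2 : ρ' = (ρ * (algebraMap K L c * x)⁻¹ - algebraMap K L d) * (algebraMap K L c * x) := by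
      rw [hρ', sub_mul, inv_mul_cancel_right₀ hcx0, map_mul, mul_assoc]
    have h3 := coe_add_one_le_iff.2 (show ((0 : ℤ) : WithTop ℤ) < _ from hd)
    rw [h2, ord_mul, hcx, add_comm m 1, WithTop.coe_add]
    exact add_le_add_left (by simpa using h3) _
  have h4 : ∑ σ : Gal(L/K), σ ρ = algebraMap K L (d * c) + ∑ σ : Gal(L/K), σ ρ' := by
    have : ρ = algebraMap K L (d * c) * x + ρ' := by rw [hρ']; ring
    conv_lhs => rw [this]
    simp only [map_add, map_mul, AlgEquiv.commutes, Finset.sum_add_distrib, ← Finset.mul_sum, hx,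
      mul_one]
  have h5 : ord (algebraMap K L (d * c)) =
      ((m + b * (Module.finrank K L - 1) : ℤ) : WithTop ℤ) := by
    rw [ord_algebraMap hram hdc]
    congr 1
    linear_combination -ht
  rw [h4, ord_add_eq_left, h5]
  rw [h5, ← coe_add_one_le_iff]
  refine le_trans (le_of_eq ?_) (htr ρ' _ h1)
  congr 1
  ring

end Trace

/-! ### The group ring of an elementary abelian group -/

section Elementary

variable {p n : ℕ} [Fact p.Prime] {F G : Type*} [Field F] [CharP F p] [CommGroup G]
  (e : G ≃* (Fin n → Multiplicative (ZMod p)))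

/-- The `j`-th basis element of an elementary abelian group with coordinates `e`. -/
def gen (j : Fin n) : G := e.symm (Pi.mulSingle j (Multiplicative.ofAdd 1))

variable (F) in
/-- The coordinates of a group element, as elements of a field of characteristic `p`. -/
def coord (g : G) (j : Fin n) : F := ZMod.castHom dvd_rfl F (Multiplicative.toAdd (e g j))

theorem eq_prod_gen_pow (g : G) :
    g = ∏ j, gen e j ^ (Multiplicative.toAdd (e g j)).val := by
  apply e.injective
  funext i
  rw [map_prod, Finset.prod_apply, Finset.prod_eq_single i]
  · rw [map_pow, Pi.pow_apply, gen, MulEquiv.apply_symm_apply, Pi.mulSingle_eq_same, ← ofAdd_nsmul,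
      nsmul_eq_mul, ZMod.natCast_zmod_val, mul_one, ofAdd_toAdd]
  · intro j _ hj
    rw [map_pow, Pi.pow_apply, gen, MulEquiv.apply_symm_apply, Pi.mulSingle_eq_of_ne hj.symm,
      one_pow]
  · simp

theorem coord_mul (g h : G) : coord F e (g * h) = coord F e g + coord F e h := by
  funext j
  simp [coord]

theorem coord_one : coord F e (1 : G) = 0 := by
  funext j
  simp [coord]

theorem coord_gen (j : Fin n) : coord F e (gen e j) = Pi.single j 1 := by
  funext i
  rw [coord, gen, MulEquiv.apply_symm_apply]
  rcases eq_or_ne i j with rfl | h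
  · rw [Pi.mulSingle_eq_same, Pi.single_eq_same, toAdd_ofAdd, map_one]
  · rw [Pi.mulSingle_eq_of_ne h, Pi.single_eq_of_ne h, toAdd_one, map_zero]

theorem natCast_val_eq_coord (g : G) (j : Fin n) :
    (((Multiplicative.toAdd (e g j)).val : ℕ) : F) = coord F e g j := by
  rw [coord, ZMod.castHom_apply, ZMod.natCast_val]

theorem gen_pow_prime (j : Fin n) : gen e j ^ p = 1 := by
  rw [gen, ← map_pow, ← Pi.mulSingle_pow, ← ofAdd_nsmul]
  simp

instance : CharP (MonoidAlgebra F G) p :=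
  charP_of_injective_algebraMap (FaithfulSMul.algebraMap_injective F (MonoidAlgebra F G)) p

theorem of_gen_sub_one_pow_prime (j : Fin n) :
    (MonoidAlgebra.of F G (gen e j) - 1) ^ p = 0 := by
  rw [sub_pow_char, one_pow, ← map_pow, gen_pow_prime, map_one, sub_self]

theorem of_sub_one_mem_augIdeal (g : G) : MonoidAlgebra.of F G g - 1 ∈ augIdeal F G := by
  rw [augIdeal, RingHom.mem_ker]
  simp [MonoidAlgebra.lift_single]

variable (F) in
/-- The first-order expansion `g ↦ 1 + coord g` of the group ring at its augmentation: it vanishes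
on the square of the augmentation ideal. -/
noncomputable def linearization : MonoidAlgebra F G →ₐ[F] TrivSqZeroExt F (Fin n → F) :=
  MonoidAlgebra.lift F _ G
    { toFun := fun g => 1 + TrivSqZeroExt.inr (coord F e g)
      map_one' := by simp [coord_one]
      map_mul' := fun g h => by
        rw [coord_mul, TrivSqZeroExt.inr_add]
        linear_combination -(TrivSqZeroExt.inr_mul_inr F (coord F e g) (coord F e h)) }

theorem linearization_of (g : G) :
    linearization F e (MonoidAlgebra.of F G g) = 1 + TrivSqZeroExt.inr (coord F e g) := by
  simp [linearization]

theorem fst_linearization (x : MonoidAlgebra F G) :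
    (linearization F e x).fst = MonoidAlgebra.lift F F G (1 : G →* F) x := by
  have : (TrivSqZeroExt.fstHom F F (Fin n → F)).comp (linearization F e) =
      MonoidAlgebra.lift F F G (1 : G →* F) := by
    refine MonoidAlgebra.algHom_ext (fun g => ?_) (AlgHom.ext fun r => ?_) <;>
      simp [linearization]
  exact DFunLike.congr_fun this x

theorem linearization_eq_zero_of_mem_sq {x : MonoidAlgebra F G} (hx : x ∈ augIdeal F G ^ 2) :
    linearization F e x = 0 := by
  rw [pow_two] at hx
  refine Submodule.mul_induction_on hx (fun a ha b hb => ?_) fun a b ha hb => by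
    rw [map_add, ha, hb, add_zero]
  have h : ∀ a ∈ augIdeal F G, ∃ v, linearization F e a = TrivSqZeroExt.inr v := fun a ha => by
    refine ⟨(linearization F e a).snd, TrivSqZeroExt.ext ?_ rfl⟩
    rw [fst_linearization]
    exact ha
  obtain ⟨v, hv⟩ := h a ha
  obtain ⟨w, hw⟩ := h b hb
  rw [map_mul, hv, hw, TrivSqZeroExt.inr_mul_inr]

/-- An element of the group ring agrees modulo the square of the augmentation ideal with its
first-order expansion. -/
theorem sub_linear_part_mem_sq (x : MonoidAlgebra F G) :
    x - MonoidAlgebra.lift F F G (1 : G →* F) x • 1 -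
      ∑ j, (linearization F e x).snd j • (MonoidAlgebra.of F G (gen e j) - 1) ∈
        augIdeal F G ^ 2 := by
  induction x using MonoidAlgebra.induction_linear with
  | zero => simp
  | add x y hx hy =>
    have := add_mem hx hy
    convert this using 1
    simp only [map_add, TrivSqZeroExt.snd_add, Pi.add_apply, add_smul, Finset.sum_add_distrib]
    ring
  | single g r =>
    have h1 : MonoidAlgebra.single g r = r • MonoidAlgebra.of F G g := by simp
    let ψ : Additive G →+ MonoidAlgebra F G ⧸ augIdeal F G ^ 2 :=
      { toFun := fun g => Ideal.Quotient.mk _ (MonoidAlgebra.of F G g.toMul - 1)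
        map_zero' := by rw [toMul_zero, map_one, sub_self, map_zero]
        map_add' := fun g h => by
          rw [← map_add, Ideal.Quotient.eq, toMul_add, map_mul]
          have : MonoidAlgebra.of F G g.toMul * MonoidAlgebra.of F G h.toMul - 1 -
              (MonoidAlgebra.of F G g.toMul - 1 + (MonoidAlgebra.of F G h.toMul - 1)) =
              (MonoidAlgebra.of F G g.toMul - 1) * (MonoidAlgebra.of F G h.toMul - 1) := by ring
          rw [this, pow_two]
          exact Ideal.mul_mem_mul (of_sub_one_mem_augIdeal _) (of_sub_one_mem_augIdeal _) }
    have h2 : MonoidAlgebra.of F G g - 1 -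
        ∑ j, coord F e g j • (MonoidAlgebra.of F G (gen e j) - 1) ∈ augIdeal F G ^ 2 := by
      rw [← Ideal.Quotient.eq, map_sum]
      change ψ (Additive.ofMul g) = _
      conv_lhs => rw [eq_prod_gen_pow e g, ofMul_prod, map_sum]
      refine Finset.sum_congr rfl fun j _ => ?_
      rw [ofMul_pow, map_nsmul, ← natCast_val_eq_coord, Nat.cast_smul_eq_nsmul, map_nsmul]
      rfl
    have h3 := Ideal.mul_mem_left (augIdeal F G ^ 2) (algebraMap F _ r) h2
    rw [← Algebra.smul_def] at h3
    rw [h1, map_smul, map_smul, linearization_of]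
    convert h3 using 1
    simp [smul_sub, Finset.smul_sum, smul_smul]

theorem sub_one_pow_prime_pred {R : Type*} [CommRing R] [Algebra F R] (x : R) :
    (x - 1) ^ (p - 1) = ∑ i ∈ Finset.range p, x ^ i := by
  have hp : 0 < p := (Fact.out : p.Prime).pos
  have h : ((X : F[X]) - 1) ^ (p - 1) = ∑ i ∈ Finset.range p, X ^ i := by
    refine mul_right_cancel₀ (b := (X : F[X]) - 1) (X_sub_C_ne_zero 1) ?_
    rw [geom_sum_mul, ← pow_succ, Nat.sub_add_cancel hp, sub_pow_char, one_pow]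
  simpa using congrArg (aeval x) h

/-- The product of the elements `(σ_j - 1) ^ (p - 1)` over a basis is the norm element. -/
theorem prod_of_gen_sub_one_pow [Fintype G] :
    ∏ j, (MonoidAlgebra.of F G (gen e j) - 1) ^ (p - 1) = ∑ g, MonoidAlgebra.of F G g := by
  have h : ∀ j, (MonoidAlgebra.of F G (gen e j) - 1) ^ (p - 1) =
      ∑ i ∈ Finset.range p, MonoidAlgebra.of F G (gen e j) ^ i :=
    fun j => sub_one_pow_prime_pred (F := F) _
  rw [Finset.prod_congr rfl fun j _ => h j, Finset.prod_univ_sum]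
  symm
  refine Finset.sum_bij (fun g _ j => (Multiplicative.toAdd (e g j)).val) ?_ ?_ ?_ ?_
  · intro g _
    rw [Fintype.mem_piFinset]
    exact fun j => Finset.mem_range.2 (ZMod.val_lt _)
  · intro g _ h _ hgh
    rw [eq_prod_gen_pow e g, eq_prod_gen_pow e h]
    exact Finset.prod_congr rfl fun j _ => congrArg _ (congrFun hgh j)
  · intro x hx
    rw [Fintype.mem_piFinset] at hx
    refine ⟨e.symm fun j => Multiplicative.ofAdd (x j : ZMod p), Finset.mem_univ _, ?_⟩
    funext j
    rw [MulEquiv.apply_symm_apply, toAdd_ofAdd,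
      ZMod.val_cast_of_lt (Finset.mem_range.1 (hx j))]
  · intro g _
    conv_lhs => rw [eq_prod_gen_pow e g, map_prod]
    simp only [map_pow]

/-- The subgroup of the elements whose coordinates outside `S` vanish. -/
def coordSubgroup (S : Finset (Fin n)) : Subgroup G where
  carrier := {g | ∀ j ∉ S, e g j = 1}
  one_mem' := by simp
  mul_mem' := fun {g h} hg hh j hj => by simp [hg j hj, hh j hj]
  inv_mem' := fun {g} hg j hj => by simp [hg j hj]

theorem card_coordSubgroup (S : Finset (Fin n)) : Nat.card (coordSubgroup e S) = p ^ S.card := by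
  classical
  let T : Finset (Fin n → Multiplicative (ZMod p)) :=
    Fintype.piFinset fun j => if j ∈ S then Finset.univ else {1}
  have h1 : T.card = p ^ S.card := by
    rw [Fintype.card_piFinset]
    have : ∀ j, (if j ∈ S then (Finset.univ : Finset (Multiplicative (ZMod p))) else {1}).card =
        if j ∈ S then p else 1 := fun j => by
      split_ifs
      · rw [Finset.card_univ, Fintype.card_multiplicative, ZMod.card]
      · simp
    simp only [this]
    rw [Finset.prod_ite_mem, Finset.univ_inter, Finset.prod_const]
  rw [← h1, ← Nat.card_eq_finsetCard]
  refine Nat.card_congr (e.toEquiv.subtypeEquiv fun g => ?_)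
  rw [Fintype.mem_piFinset]
  refine forall_congr' fun j => ?_
  by_cases h : j ∈ S <;> simp [h]

end Elementary

/-! ### First-order coordinates of the truncated group -/

section TruncCoord

theorem truncPow_one_add_inr {p : ℕ} [Fact p.Prime] {F : Type*} [Field F] {M : Type*}
    [AddCommGroup M] [Module F M] [Module Fᵐᵒᵖ M] [IsCentralScalar F M] (ω : F) (d : M) :
    truncPow p ω (1 + TrivSqZeroExt.inr d : TrivSqZeroExt F M) =
      1 + TrivSqZeroExt.inr (ω • d) := by
  obtain ⟨q, hq⟩ : ∃ q, p = q + 2 := Nat.exists_eq_add_of_le' (Fact.out : p.Prime).two_le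
  rw [truncPow, hq, Finset.sum_range_succ', Finset.sum_range_succ']
  have h : ∀ i ∈ Finset.range q, binom ω (i + 1 + 1) •
      (1 + TrivSqZeroExt.inr d - 1 : TrivSqZeroExt F M) ^ (i + 1 + 1) = 0 := fun i _ => by
    rw [add_sub_cancel_left, pow_succ, pow_succ, mul_assoc, TrivSqZeroExt.inr_mul_inr, mul_zero,
      smul_zero]
  rw [Finset.sum_eq_zero h]
  simp [binom, add_comm]

theorem groupElt_mul {p k : ℕ} {F G : Type*} [Field F] [CommGroup G] (g h : G) :
    groupElt p k F (g * h) = groupElt p k F g + groupElt p k F h := by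
  apply TruncGroup.val_injective
  rw [TruncGroup.val_add]
  change Ideal.Quotient.mk (augIdeal F G ^ k) (MonoidAlgebra.of F G (g * h)) =
    Ideal.Quotient.mk _ (MonoidAlgebra.of F G g) * Ideal.Quotient.mk _ (MonoidAlgebra.of F G h)
  rw [map_mul, map_mul]

/-- Representatives of an element of `(1 + A) / (1 + A ^ k)` lie in `1 + A`. -/
theorem sub_one_mem_augIdeal_of_mk_eq {p k : ℕ} {F G : Type*} [Field F] [CommGroup G]
    (hk : 2 ≤ k) {u : TruncGroup p k F G} {x : MonoidAlgebra F G}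
    (hx : Ideal.Quotient.mk (augIdeal F G ^ k) x = u.val) :
    x - 1 ∈ augIdeal F G := by
  have h1 := u.val_mem
  rw [← hx, ← map_one (Ideal.Quotient.mk (augIdeal F G ^ k)), ← map_sub, augIdealQuot,
    Ideal.mem_map_iff_of_surjective _ Ideal.Quotient.mk_surjective] at h1
  obtain ⟨y, hy, hxy⟩ := h1
  rw [Ideal.Quotient.eq] at hxy
  have h2 := sub_mem hy (Ideal.pow_le_self (by omega) hxy)
  rwa [sub_sub_cancel] at h2

variable {p n k : ℕ} [Fact p.Prime] {F G : Type*} [Field F] [CharP F p] [CommGroup G]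
  (e : G ≃* (Fin n → Multiplicative (ZMod p)))

/-- The linearization on the quotient by the `k`-th power of the augmentation ideal, `k ≥ 2`. -/
noncomputable def linearizationQuot (hk : 2 ≤ k) :
    GroupRingQuot k F G →ₐ[F] TrivSqZeroExt F (Fin n → F) :=
  Ideal.Quotient.liftₐ _ (linearization F e) fun _ hx =>
    linearization_eq_zero_of_mem_sq e (Ideal.pow_le_pow_right hk hx)

theorem linearizationQuot_mk (hk : 2 ≤ k) (x : MonoidAlgebra F G) :
    linearizationQuot e hk (Ideal.Quotient.mk _ x) = linearization F e x := rfl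

theorem linearizationQuot_val (hk : 2 ≤ k) (u : TruncGroup p k F G) :
    linearizationQuot e hk u.val =
      1 + TrivSqZeroExt.inr (linearizationQuot e hk u.val).snd := by
  obtain ⟨x, hx⟩ := Ideal.Quotient.mk_surjective u.val
  have h : MonoidAlgebra.lift F F G (1 : G →* F) (x - 1) = 0 :=
    sub_one_mem_augIdeal_of_mk_eq hk hx
  rw [map_sub, sub_eq_zero] at h
  refine TrivSqZeroExt.ext ?_ (by simp)
  rw [← hx, linearizationQuot_mk, fst_linearization, h]
  simp

/-- The first-order coordinates of an element of `(1 + A) / (1 + A ^ k)`, a linear map by which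
this group surjects onto `A / A ^ 2 ≅ F ^ n`. -/
noncomputable def truncCoord [Fact (k ≤ p)] (hk : 2 ≤ k) :
    TruncGroup p k F G →ₗ[F] (Fin n → F) where
  toFun u := (linearizationQuot e hk u.val).snd
  map_add' u v := by
    rw [TruncGroup.val_add, map_mul, linearizationQuot_val e hk u, linearizationQuot_val e hk v]
    simp [add_comm]
  map_smul' ω u := by
    have h : linearizationQuot e hk (truncPow p ω u.val) =
        truncPow p ω (linearizationQuot e hk u.val) := by
      simp [truncPow]
    rw [TruncGroup.val_smul, h, linearizationQuot_val e hk u, truncPow_one_add_inr]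
    simp

variable [Fact (k ≤ p)]

theorem truncCoord_eq_of_mk_eq (hk : 2 ≤ k) {u : TruncGroup p k F G}
    {x : MonoidAlgebra F G} (hx : Ideal.Quotient.mk (augIdeal F G ^ k) x = u.val) :
    truncCoord e hk u = (linearization F e x).snd := by
  change (linearizationQuot e hk u.val).snd = _
  rw [← hx, linearizationQuot_mk]

theorem truncCoord_groupElt (hk : 2 ≤ k) (g : G) :
    truncCoord e hk (groupElt p k F g) = coord F e g := by
  have : Ideal.Quotient.mk (augIdeal F G ^ k) (MonoidAlgebra.of F G g) =
    (groupElt p k F g).val := rfl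
  rw [truncCoord_eq_of_mk_eq e hk this, linearization_of]
  simp

theorem eq_sum_truncCoord_smul (hk : 2 ≤ k) {u : TruncGroup p k F G} (hu : u ∈ groupSpan p k F G) :
    u = ∑ j, truncCoord e hk u j • groupElt p k F (gen e j) := by
  induction hu using Submodule.span_induction with
  | mem u hu =>
    obtain ⟨g, rfl⟩ := hu
    let ψ : Additive G →+ TruncGroup p k F G :=
      AddMonoidHom.mk' (fun g => groupElt p k F g.toMul) fun g h => groupElt_mul _ _
    rw [truncCoord_groupElt]
    change ψ (Additive.ofMul g) = _
    conv_lhs => rw [eq_prod_gen_pow e g, ofMul_prod, map_sum]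
    refine Finset.sum_congr rfl fun j _ => ?_
    rw [ofMul_pow, map_nsmul, ← natCast_val_eq_coord, Nat.cast_smul_eq_nsmul]
    rfl
  | zero => simp
  | add u v _ _ hu hv =>
    conv_lhs => rw [hu, hv]
    simp [add_smul, Finset.sum_add_distrib]
  | smul ω u _ hu =>
    conv_lhs => rw [hu]
    simp [Finset.smul_sum, smul_smul]

/-- The first-order coordinates identify the span of the image of an elementary abelian group of
rank `n` with `F ^ n`. -/
noncomputable def groupSpanEquiv (hk : 2 ≤ k) : groupSpan p k F G ≃ₗ[F] (Fin n → F) :=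
  LinearEquiv.ofBijective ((truncCoord e hk).domRestrict (groupSpan p k F G)) <| by
    constructor
    · rw [← LinearMap.ker_eq_bot, LinearMap.ker_eq_bot']
      intro u hu
      apply Subtype.ext
      have hu' : truncCoord e hk (u : TruncGroup p k F G) = 0 := hu
      rw [eq_sum_truncCoord_smul e hk u.2, hu']
      simp
    · intro d
      refine ⟨⟨∑ j, d j • groupElt p k F (gen e j), Submodule.sum_mem _ fun j _ =>
        Submodule.smul_mem _ _ (Submodule.subset_span ⟨_, rfl⟩)⟩, ?_⟩
      rw [LinearMap.domRestrict_apply, map_sum]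
      simp only [map_smul, truncCoord_groupElt, coord_gen]
      simpa using (pi_eq_sum_univ' d).symm

end TruncCoord

/-! ### The action of the group ring -/

section Action

variable {p : ℕ} {K L : Type*} [Fact p.Prime] [Field K] [CharP K p] [Field L] [Algebra K L]

theorem act_single (σ : Gal(L/K)) (c : coeffField p K) (x : L) :
    act (MonoidAlgebra.single σ c : GalRing p K L) x = algebraMap K L c * σ x := by
  simp [act]

theorem act_of (σ : Gal(L/K)) (x : L) :
    act (MonoidAlgebra.of (coeffField p K) Gal(L/K) σ) x = σ x := by
  rw [MonoidAlgebra.of_apply, act_single]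
  simp

variable (p K L) in
theorem commute_algebraMap_toLinearMapHom (c : coeffField p K) (σ : Gal(L/K)) :
    Commute (((algebraMap K (Module.End K L)).comp (coeffField p K).subtype) c)
      (AlgEquiv.toLinearMapHom K L σ) :=
  Algebra.commutes (c : K) _

variable (p K L) in
/-- The action of the group ring on `L`, as a ring homomorphism to the endomorphisms of `L`. -/
noncomputable def actHom : GalRing p K L →+* Module.End K L :=
  MonoidAlgebra.liftNCRingHom ((algebraMap K (Module.End K L)).comp (coeffField p K).subtype)
    (AlgEquiv.toLinearMapHom K L) (commute_algebraMap_toLinearMapHom p K L)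

theorem act_eq_actHom (γ : GalRing p K L) (x : L) : act γ x = actHom p K L γ x := by
  induction γ using MonoidAlgebra.induction_linear with
  | zero => simp [act]
  | add γ δ h1 h2 =>
    rw [map_add, LinearMap.add_apply, ← h1, ← h2, act, MonoidAlgebra.coeff_add,
      Finsupp.sum_add_index']
    · rfl
    · simp
    · simp [add_mul]
  | single σ c =>
    rw [actHom, MonoidAlgebra.liftNCRingHom_single, act, MonoidAlgebra.coeff_single,
      Finsupp.sum_single_index (by simp)]
    simp [Algebra.smul_def]

theorem act_add (γ δ : GalRing p K L) (x : L) : act (γ + δ) x = act γ x + act δ x := by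
  simp [act_eq_actHom]

theorem act_sub (γ δ : GalRing p K L) (x : L) : act (γ - δ) x = act γ x - act δ x := by
  simp [act_eq_actHom]

theorem act_mul (γ δ : GalRing p K L) (x : L) : act (γ * δ) x = act γ (act δ x) := by
  simp [act_eq_actHom]

theorem act_zero (x : L) : act (0 : GalRing p K L) x = 0 := by
  simp [act_eq_actHom]

theorem act_one (x : L) : act (1 : GalRing p K L) x = x := by
  simp [act_eq_actHom]

theorem act_sum {ι : Type*} (s : Finset ι) (γ : ι → GalRing p K L) (x : L) :
    act (∑ i ∈ s, γ i) x = ∑ i ∈ s, act (γ i) x := by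
  simp [act_eq_actHom]

theorem act_smul (c : coeffField p K) (γ : GalRing p K L) (x : L) :
    act (c • γ) x = algebraMap K L c * act γ x := by
  have h : c • γ = MonoidAlgebra.single (1 : Gal(L/K)) c * γ := by
    rw [Algebra.smul_def]
    rfl
  rw [h, act_mul, act_single, AlgEquiv.one_apply]

theorem galois_act [IsAbelianGalois K L] (γ : GalRing p K L) (σ : Gal(L/K)) (x : L) :
    σ (act γ x) = act γ (σ x) := by
  rw [← act_of (p := p) σ (act γ x), ← act_mul, mul_comm, act_mul, act_of]

end Action

/-! ### Shifts of valuations by elements of the augmentation ideal -/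

section Shift

/-- The metric properties of the Galois action on a totally ramified extension with the single
ramification break `b`: automorphisms are isometries, nonzero constants are units, and
automorphisms move the elements of the fixed field of `H` by at least `b |H|`. -/
structure HasBreakBound (p b : ℕ) (K L : Type*) [Fact p.Prime] [Field K] [CharP K p] [Field L]
    [Algebra K L] [Valued L ℤᵐ⁰] : Prop where
  ord_galois : ∀ (σ : Gal(L/K)) (x : L), ord (σ x) = ord x
  ord_coeff : ∀ c : coeffField p K, c ≠ 0 → ord (algebraMap K L c) = 0
  le_ord_sub : ∀ (H : Subgroup Gal(L/K)) (y : L), (∀ τ ∈ H, τ y = y) →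
    ∀ (σ : Gal(L/K)) (m : ℤ), (m : WithTop ℤ) ≤ ord y →
      ((m + b * Nat.card H : ℤ) : WithTop ℤ) ≤ ord (σ y - y)

theorem HasBreakBound.le_ord_coeff_mul {p b : ℕ} {K L : Type*} [Fact p.Prime]
    [Field K] [CharP K p] [Field L] [Algebra K L] [Valued L ℤᵐ⁰]
    (hB : HasBreakBound p b K L) (c : coeffField p K) (x : L) :
    ord x ≤ ord (algebraMap K L c * x) := by
  rcases eq_or_ne c 0 with rfl | hc
  · simp [ord_zero]
  · rw [ord_mul, hB.ord_coeff c hc, zero_add]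

theorem le_ord_act {p b : ℕ} {K L : Type*} [Fact p.Prime] [Field K] [CharP K p] [Field L]
    [Algebra K L] [Valued L ℤᵐ⁰] (hB : HasBreakBound p b K L) {y : L} {m : ℤ}
    (hm : (m : WithTop ℤ) ≤ ord y) (γ : GalRing p K L) : (m : WithTop ℤ) ≤ ord (act γ y) := by
  induction γ using MonoidAlgebra.induction_linear with
  | zero => simp [act_zero, ord_zero]
  | add γ δ h1 h2 =>
    rw [act_add]
    exact le_ord_add h1 h2
  | single σ c =>
    rw [act_single]
    refine le_trans ?_ (hB.le_ord_coeff_mul c _)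
    rwa [hB.ord_galois]

variable {p n b : ℕ} {K L : Type*} [Fact p.Prime] [Field K] [Field L] [Algebra K L]
  [IsAbelianGalois K L]

theorem finrank_eq_pow [FiniteDimensional K L]
    (e : Gal(L/K) ≃* (Fin n → Multiplicative (ZMod p))) : Module.finrank K L = p ^ n := by
  rw [← IsGalois.card_aut_eq_finrank, Nat.card_congr e.toEquiv, Nat.card_eq_fintype_card,
    Fintype.card_pi, Finset.prod_const]
  simp

/-- `y` is fixed by the basis elements of the Galois group with index in `S`. -/
def IsFixedBy (e : Gal(L/K) ≃* (Fin n → Multiplicative (ZMod p))) (S : Finset (Fin n)) (y : L) :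
    Prop :=
  ∀ j ∈ S, gen e j y = y

variable {e : Gal(L/K) ≃* (Fin n → Multiplicative (ZMod p))} {S : Finset (Fin n)} {y : L}

theorem IsFixedBy.apply_eq (hy : IsFixedBy e S y) {g : Gal(L/K)} (hg : g ∈ coordSubgroup e S) :
    g y = y := by
  have h : g ∈ MulAction.stabilizer Gal(L/K) y := by
    rw [eq_prod_gen_pow e g]
    refine Subgroup.prod_mem _ fun j _ => ?_
    by_cases hj : j ∈ S
    · exact Subgroup.pow_mem _ (hy j hj) _
    · rw [hg j hj, toAdd_one, ZMod.val_zero, pow_zero]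
      exact Subgroup.one_mem _
  exact h

theorem isFixedBy_empty (y : L) : IsFixedBy e ∅ y := fun j hj => absurd hj (Finset.notMem_empty j)

variable [CharP K p]

theorem IsFixedBy.act (hy : IsFixedBy e S y) (γ : GalRing p K L) : IsFixedBy e S (act γ y) :=
  fun j hj => by rw [galois_act, hy j hj]

variable (p e) in
/-- The partial norm element `∏_{j ∈ T} (σ_j - 1) ^ (p - 1)`. -/
noncomputable def partialNorm (T : Finset (Fin n)) : GalRing p K L :=
  ∏ j ∈ T, (MonoidAlgebra.of (coeffField p K) Gal(L/K) (gen e j) - 1) ^ (p - 1)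

theorem isFixedBy_union_act_partialNorm {T : Finset (Fin n)} (hy : IsFixedBy e S y) :
    IsFixedBy e (S ∪ T) (act (partialNorm p e T) y) := by
  intro j hj
  rcases Finset.mem_union.1 hj with hj | hj
  · exact hy.act _ j hj
  · have hp : (p - 1) + 1 = p := Nat.sub_add_cancel (Fact.out : p.Prime).pos
    have h : (MonoidAlgebra.of (coeffField p K) Gal(L/K) (gen e j) - 1) *
        partialNorm p e T = 0 := by
      rw [partialNorm, ← Finset.mul_prod_erase T _ hj, ← mul_assoc, ← pow_succ', hp,
        of_gen_sub_one_pow_prime, zero_mul]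
    have h2 : act (MonoidAlgebra.of (coeffField p K) Gal(L/K) (gen e j) - 1)
        (act (partialNorm p e T) y) = 0 := by
      rw [← act_mul, h, act_zero]
    rwa [act_sub, act_of, act_one, sub_eq_zero] at h2

theorem act_partialNorm_univ [FiniteDimensional K L] (y : L) :
    act (partialNorm p e Finset.univ) y = ∑ σ : Gal(L/K), σ y := by
  rw [partialNorm, prod_of_gen_sub_one_pow, act_sum]
  simp only [act_of]

variable [Valued L ℤᵐ⁰] {m : ℤ}

/-- On the elements fixed by `σ_j` for `j ∈ S`, an element of the group ring acts as its
augmentation up to a shift of the valuation by `b p ^ |S|`. -/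
theorem le_ord_act_sub (hB : HasBreakBound p b K L) (hy : IsFixedBy e S y)
    (hm : (m : WithTop ℤ) ≤ ord y) (γ : GalRing p K L) :
    ((m + b * p ^ S.card : ℤ) : WithTop ℤ) ≤ ord (act γ y -
      algebraMap K L (MonoidAlgebra.lift (coeffField p K) (coeffField p K) Gal(L/K)
        (1 : Gal(L/K) →* coeffField p K) γ : coeffField p K) * y) := by
  induction γ using MonoidAlgebra.induction_linear with
  | zero => simp [act_zero, ord_zero]
  | add γ δ h1 h2 =>
    have := le_ord_add h1 h2
    convert this using 2
    rw [act_add, map_add, Subfield.coe_add, map_add]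
    ring
  | single σ c =>
    have h := hB.le_ord_sub (coordSubgroup e S) y (fun τ hτ => hy.apply_eq hτ) σ m hm
    rw [card_coordSubgroup] at h
    have h1 : act (MonoidAlgebra.single σ c : GalRing p K L) y -
        algebraMap K L (MonoidAlgebra.lift (coeffField p K) (coeffField p K) Gal(L/K)
          (1 : Gal(L/K) →* coeffField p K) (MonoidAlgebra.single σ c) : coeffField p K) * y =
        algebraMap K L c * (σ y - y) := by
      rw [act_single, MonoidAlgebra.lift_single]
      simp [mul_sub]
    rw [h1]
    refine le_trans ?_ (hB.le_ord_coeff_mul c _)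
    exact_mod_cast h

theorem le_ord_act_of_mem (hB : HasBreakBound p b K L) (hy : IsFixedBy e S y)
    (hm : (m : WithTop ℤ) ≤ ord y) {α : GalRing p K L}
    (hα : α ∈ augIdeal (coeffField p K) Gal(L/K)) :
    ((m + b * p ^ S.card : ℤ) : WithTop ℤ) ≤ ord (act α y) := by
  have h := le_ord_act_sub hB hy hm α
  have h1 : MonoidAlgebra.lift (coeffField p K) (coeffField p K) Gal(L/K)
    (1 : Gal(L/K) →* coeffField p K) α = 0 := hα
  rw [h1] at h
  simpa using h

theorem le_ord_act_of_mem_sq (hB : HasBreakBound p b K L) (hy : IsFixedBy e S y)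
    (hm : (m : WithTop ℤ) ≤ ord y) {α : GalRing p K L}
    (hα : α ∈ augIdeal (coeffField p K) Gal(L/K) ^ 2) :
    ((m + 2 * (b * p ^ S.card) : ℤ) : WithTop ℤ) ≤ ord (act α y) := by
  rw [pow_two] at hα
  refine Submodule.mul_induction_on hα (fun β hβ γ hγ => ?_) fun β γ hβ hγ => ?_
  · rw [act_mul, two_mul, ← add_assoc]
    exact le_ord_act_of_mem hB (hy.act γ) (le_ord_act_of_mem hB hy hm hγ) hβ
  · rw [act_add]
    exact le_ord_add hβ hγ

theorem le_ord_act_pow (hB : HasBreakBound p b K L) (hy : IsFixedBy e S y)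
    (hm : (m : WithTop ℤ) ≤ ord y) {α : GalRing p K L}
    (hα : α ∈ augIdeal (coeffField p K) Gal(L/K)) (i : ℕ) :
    ((m + i * (b * p ^ S.card) : ℤ) : WithTop ℤ) ≤ ord (act (α ^ i) y) := by
  induction i with
  | zero => simpa [act_one] using hm
  | succ i ih =>
    rw [pow_succ', act_mul]
    have := le_ord_act_of_mem hB (hy.act (α ^ i)) ih hα
    convert this using 2
    push_cast
    ring

/-- The partial norm over `T` shifts the valuation of an element fixed by `S` as much as a trace
over a subgroup of order `p ^ |T|` does. -/
theorem le_ord_act_partialNorm (hB : HasBreakBound p b K L) (T : Finset (Fin n))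
    (hST : Disjoint S T) (hy : IsFixedBy e S y) (hm : (m : WithTop ℤ) ≤ ord y) :
    ((m + b * (p ^ (S.card + T.card) - p ^ S.card) : ℤ) : WithTop ℤ) ≤
      ord (act (partialNorm p e T) y) := by
  classical
  induction T using Finset.induction with
  | empty => simpa [partialNorm, act_one] using hm
  | insert j T hj ih =>
    have hST' : Disjoint S T := hST.mono_right (Finset.subset_insert j T)
    have h1 : partialNorm p e (insert j T) =
        (MonoidAlgebra.of (coeffField p K) Gal(L/K) (gen e j) - 1) ^ (p - 1) *
          partialNorm p e T := by
      rw [partialNorm, Finset.prod_insert hj, partialNorm]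
    have h2 := le_ord_act_pow hB (isFixedBy_union_act_partialNorm (T := T) hy) (ih hST')
      (of_sub_one_mem_augIdeal (F := coeffField p K) (gen e j)) (p - 1)
    rw [h1, act_mul]
    convert h2 using 2
    rw [Finset.card_union_of_disjoint hST', Finset.card_insert_of_notMem hj,
      Nat.cast_sub (Fact.out : p.Prime).pos, ← add_assoc, pow_succ]
    push_cast
    ring

theorem le_ord_trace [FiniteDimensional K L] (e : Gal(L/K) ≃* (Fin n → Multiplicative (ZMod p)))
    (hB : HasBreakBound p b K L) (hm : (m : WithTop ℤ) ≤ ord y) :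
    ((m + b * (Module.finrank K L - 1) : ℤ) : WithTop ℤ) ≤ ord (∑ σ : Gal(L/K), σ y) := by
  have h := le_ord_act_partialNorm (e := e) hB Finset.univ (Finset.disjoint_empty_left _)
    (isFixedBy_empty y) hm
  rw [act_partialNorm_univ] at h
  rw [finrank_eq_pow e]
  simpa using h

/-- If the linear part of `α` is supported on `S ∪ {l}` with a nonzero coefficient at `l`, then `α`
shifts the valuation of an element with smallest possible trace by at most `b p ^ |S|`. Applying the
norm element of `S`, one may replace `α` by its leading term `σ_l - 1`; the shifts of the remaining
factors of the trace then leave no room for a larger shift by `σ_l - 1`. -/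
theorem ord_act_le [FiniteDimensional K L] (hB : HasBreakBound p b K L) {ρ : L}
    (hρ : ord ρ = m) (hb : 0 < b)
    (htr : ord (∑ σ : Gal(L/K), σ ρ) = ((m + b * (Module.finrank K L - 1) : ℤ) : WithTop ℤ))
    {l : Fin n} (hl : l ∉ S) {α : GalRing p K L} (hα : α ∈ augIdeal (coeffField p K) Gal(L/K))
    (hαl : (linearization (coeffField p K) e α).snd l ≠ 0)
    (hαS : ∀ j ∉ insert l S, (linearization (coeffField p K) e α).snd j = 0) :
    ord (act α ρ) ≤ ((m + b * p ^ S.card : ℤ) : WithTop ℤ) := by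
  have hp := (Fact.out : p.Prime)
  set s := S.card with hs
  set σl : GalRing p K L := MonoidAlgebra.of (coeffField p K) Gal(L/K) (gen e l) - 1 with hσl
  have hσlA : σl ∈ augIdeal (coeffField p K) Gal(L/K) := of_sub_one_mem_augIdeal _
  set y := act (partialNorm p e S) ρ with hy
  have hyfix : IsFixedBy e S y := by
    have := isFixedBy_union_act_partialNorm (e := e) (T := S) (isFixedBy_empty ρ)
    rwa [Finset.empty_union] at this
  have hyord : ((m + b * (p ^ s - 1) : ℤ) : WithTop ℤ) ≤ ord y := by
    have := le_ord_act_partialNorm hB S (Finset.disjoint_empty_left _) (isFixedBy_empty (e := e) ρ)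
      hρ.ge
    simpa using this
  set z := act σl y with hz
  have hzfix : IsFixedBy e S z := hyfix.act _
  -- the exact valuation of `z`
  -- otherwise the remaining factors of the norm element would push the trace beyond its valuation
  have hzle : ord z ≤ ((m + b * (2 * p ^ s - 1) : ℤ) : WithTop ℤ) := by
    by_contra hlt
    rw [not_le, ← coe_add_one_le_iff] at hlt
    have h1 := le_ord_act_pow hB hzfix hlt hσlA (p - 2)
    have h2 : act (σl ^ (p - 2)) z = act (partialNorm p e {l}) y := by
      rw [hz, ← act_mul, ← pow_succ, partialNorm, Finset.prod_singleton]
      congr 2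
      have := hp.two_le
      omega
    have h3 : IsFixedBy e (S ∪ {l}) (act (partialNorm p e {l}) y) :=
      isFixedBy_union_act_partialNorm hyfix
    rw [h2] at h1
    have h4 := le_ord_act_partialNorm hB (S ∪ {l})ᶜ disjoint_compl_right h3 h1
    have h5 : act (partialNorm p e (S ∪ {l})ᶜ) (act (partialNorm p e {l}) y) =
        ∑ σ : Gal(L/K), σ ρ := by
      rw [hy, ← act_mul, ← act_mul, ← act_partialNorm_univ (p := p) (e := e)]
      congr 1
      rw [mul_assoc, partialNorm, partialNorm, partialNorm, mul_comm (∏ j ∈ {l}, _),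
        ← Finset.prod_union (Finset.disjoint_singleton_right.2 hl), mul_comm,
        Finset.prod_mul_prod_compl, partialNorm]
    have hcard : (S ∪ {l}).card = s + 1 := by
      rw [Finset.card_union_of_disjoint (Finset.disjoint_singleton_right.2 hl),
        Finset.card_singleton]
    rw [h5, htr, WithTop.coe_le_coe, Finset.card_add_card_compl, hcard, Fintype.card_fin,
      finrank_eq_pow e, Nat.cast_sub hp.two_le, ← hs, pow_succ] at h4
    push_cast at h4
    nlinarith
  have hzord : ord z = ((m + b * (2 * p ^ s - 1) : ℤ) : WithTop ℤ) := by
    refine le_antisymm hzle (le_trans (le_of_eq ?_) (le_ord_act_of_mem hB hyfix hyord hσlA))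
    congr 1
    ring
  -- the leading term of `α y`
  have hαy : ord (act α y) = ord z := by
    set c := (linearization (coeffField p K) e α).snd with hc
    set a := α - ∑ j, c j • (MonoidAlgebra.of (coeffField p K) Gal(L/K) (gen e j) - 1) with ha
    have ha2 : a ∈ augIdeal (coeffField p K) Gal(L/K) ^ 2 := by
      have := sub_linear_part_mem_sq (F := coeffField p K) e α
      have h0 : MonoidAlgebra.lift (coeffField p K) (coeffField p K) Gal(L/K)
        (1 : Gal(L/K) →* coeffField p K) α = 0 := hα
      rwa [h0, zero_smul, sub_zero] at this
    have h1 : act α y = algebraMap K L (c l) * z + act a y := by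
      have h2 : α = ∑ j, c j • (MonoidAlgebra.of (coeffField p K) Gal(L/K) (gen e j) - 1) + a := by
        rw [ha, add_sub_cancel]
      conv_lhs => rw [h2]
      rw [act_add, act_sum, Finset.sum_eq_single l, act_smul]
      · intro j _ hjl
        rw [act_smul]
        by_cases hj : j ∈ S
        · rw [act_sub, act_of, act_one, hyfix j hj, sub_self, mul_zero]
        · rw [hαS j (by simp [hjl, hj])]
          simp
      · simp
    have h3 : ord (algebraMap K L (c l) * z) = ord z := by
      rw [ord_mul, hB.ord_coeff _ hαl, zero_add]
    rw [h1, ord_add_eq_left, h3]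
    rw [h3, hzord]
    refine lt_of_lt_of_le ?_ (le_ord_act_of_mem_sq hB hyfix hyord ha2)
    rw [WithTop.coe_lt_coe]
    have : (0 : ℤ) < b * p ^ s := by
      have := hp.pos
      positivity
    linarith
  by_contra hlt
  rw [not_le, ← coe_add_one_le_iff] at hlt
  have h1 := le_ord_act_partialNorm hB S (Finset.disjoint_empty_left _)
    (isFixedBy_empty (e := e) (act α ρ)) hlt
  rw [← act_mul, mul_comm (partialNorm p e S) α, act_mul, ← hy, hαy, hzord,
    WithTop.coe_le_coe] at h1
  simp only [Finset.card_empty, zero_add, pow_zero, ← hs] at h1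
  linarith

end Shift

/-! ### Jumps of filtrations of vector spaces -/

section Jumps

/-- A decreasing sequence of dimensions from `n` to `0` is the counting function of a monotone
sequence of `n` natural numbers. -/
theorem exists_monotone_le_iff {n H : ℕ} {d : ℕ → ℕ} (hd : Antitone d) (h0 : d 0 = n)
    (hH : d H = 0) :
    ∃ c : Fin n → ℕ, Monotone c ∧ ∀ h i, h ≤ c i ↔ n - (i : ℕ) ≤ d h := by
  have key : ∀ (h : ℕ) (i : Fin n),
      h ≤ Nat.findGreatest (fun h => n - (i : ℕ) ≤ d h) H ↔ n - (i : ℕ) ≤ d h := by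
    intro h i
    constructor
    · intro hle
      have h1 : n - (i : ℕ) ≤ d (Nat.findGreatest (fun h => n - (i : ℕ) ≤ d h) H) :=
        Nat.findGreatest_spec (P := fun h => n - (i : ℕ) ≤ d h) (Nat.zero_le H) (by omega)
      exact h1.trans (hd hle)
    · intro hle
      refine Nat.le_findGreatest ?_ hle
      by_contra hlt
      have := hd (not_le.1 hlt).le
      omega
  exact ⟨_, fun i j hij => by
    have h1 := (key _ i).1 le_rfl
    have h2 : (i : ℕ) ≤ j := hij
    exact (key _ j).2 (by omega), key⟩

theorem card_eq_sub_of_le_iff {n : ℕ} {d : ℕ → ℕ} (hd : Antitone d) (h0 : d 0 = n)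
    {c : Fin n → ℕ} (hc : ∀ h i, h ≤ c i ↔ n - (i : ℕ) ≤ d h) (h : ℕ) :
    Nat.card {i : Fin n // c i = h} = d h - d (h + 1) := by
  have h1 := hd (Nat.zero_le h)
  have h2 := hd (Nat.le_succ h)
  have hiff : ∀ i, c i = h ↔ n - d h ≤ (i : ℕ) ∧ (i : ℕ) < n - d (h + 1) := by
    intro i
    have h3 := hc h i
    have h4 := hc (h + 1) i
    omega
  have hcard : (Finset.Ico (n - d h) (n - d (h + 1))).card = d h - d (h + 1) := by
    rw [Nat.card_Ico]
    have : d h.succ = d (h + 1) := rfl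
    omega
  rw [← hcard, ← Nat.card_eq_finsetCard]
  refine Nat.card_congr
    { toFun := fun i => ⟨i.1, Finset.mem_Ico.2 ((hiff i.1).1 i.2)⟩
      invFun := fun j => ⟨⟨j.1, by have := Finset.mem_Ico.1 j.2; omega⟩,
        (hiff _).2 (Finset.mem_Ico.1 j.2)⟩
      left_inv := fun i => rfl
      right_inv := fun j => rfl }

variable {F V : Type*} [Field F] [AddCommGroup V] [Module F V]

/-- The jumps of a decreasing filtration of an `n`-dimensional space, counted with multiplicity. -/
theorem exists_jumps {n H : ℕ} {W : ℕ → Submodule F V} (hW : Antitone W)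
    [FiniteDimensional F (W 0)] (h0 : Module.finrank F (W 0) = n) (hH : W H = ⊥) (B : Fin n → ℕ)
    (hB : ∀ i, Module.finrank F (W (B i + 1)) + i + 1 ≤ n) :
    ∃ c : Fin n → ℕ, Monotone c ∧ {h | W (h + 1) ≠ W h} = Set.range c ∧
      (∀ h, Nat.card {i : Fin n // c i = h} =
        Module.finrank F (W h) - Module.finrank F (W (h + 1))) ∧ ∀ i, c i ≤ B i := by
  have hfin : ∀ h, FiniteDimensional F (W h) := fun h =>
    Submodule.finiteDimensional_of_le (hW (Nat.zero_le h))
  have hd : Antitone fun h => Module.finrank F (W h) := fun h h' hh =>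
    Submodule.finrank_mono (hW hh)
  obtain ⟨c, hmono, hc⟩ := exists_monotone_le_iff hd h0 (H := H) (by rw [hH]; simp)
  have hcard := card_eq_sub_of_le_iff hd h0 hc
  refine ⟨c, hmono, ?_, hcard, fun i => ?_⟩
  · ext h
    have h1 : h ∈ Set.range c ↔ Nat.card {i : Fin n // c i = h} ≠ 0 := by
      rw [Nat.card_ne_zero, nonempty_subtype]
      exact ⟨fun h => ⟨h, inferInstance⟩, fun h => h.1⟩
    have h2 := hd (Nat.le_succ h)
    rw [h1, hcard, Set.mem_ofPred_eq, not_iff_not]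
    constructor
    · intro h
      rw [h, Nat.sub_self]
    · intro h
      refine Submodule.eq_of_le_of_finrank_eq (hW (Nat.le_succ _)) ?_
      simp only [Nat.succ_eq_add_one] at h2
      omega
  · by_contra hlt
    have h1 := (hc (B i + 1) i).1 (by omega)
    have h2 := hB i
    omega

theorem finrank_quotient_submoduleOf {M N : Submodule F V} [FiniteDimensional F M] (h : N ≤ M) :
    Module.finrank F (M ⧸ N.submoduleOf M) = Module.finrank F M - Module.finrank F N := by
  have h1 := Submodule.finrank_quotient_add_finrank (N.submoduleOf M)
  rw [(Submodule.submoduleOfEquivOfLe h).finrank_eq] at h1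
  omega

end Jumps

section Suprema

/-- Nonempty sets in `ℤ ∪ {∞}` attain their supremum unless they are unbounded sets of integers. -/
theorem isGreatest_sSup_withTop {S : Set (WithTop ℤ)} (hne : S.Nonempty)
    (hS : ⊤ ∈ S ∨ ∃ B : ℤ, ∀ x ∈ S, x ≤ B) : IsGreatest S (sSup S) := by
  have key : ∃ x, IsGreatest S x := by
    rcases hS with h | ⟨B, hB⟩
    · exact ⟨⊤, h, fun x _ => le_top⟩
    · obtain ⟨x, hx⟩ := hne
      obtain ⟨k, rfl⟩ := WithTop.ne_top_iff_exists.1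
        (lt_of_le_of_lt (hB x hx) (WithTop.coe_lt_top B)).ne
      obtain ⟨m, hm, hmax⟩ := Int.exists_greatest_of_bdd (P := fun m : ℤ => (m : WithTop ℤ) ∈ S)
        ⟨B, fun z hz => WithTop.coe_le_coe.1 (hB _ hz)⟩ ⟨k, hx⟩
      refine ⟨m, hm, fun y hy => ?_⟩
      obtain ⟨l, rfl⟩ := WithTop.ne_top_iff_exists.1
        (lt_of_le_of_lt (hB y hy) (WithTop.coe_lt_top B)).ne
      exact WithTop.coe_le_coe.2 (hmax l hy)
  obtain ⟨x, hx⟩ := key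
  rwa [hx.csSup_eq]

theorem le_sub_coe_iff {h r : ℤ} {u : WithTop ℤ} :
    (h : WithTop ℤ) ≤ u - (r : WithTop ℤ) ↔ ((h + r : ℤ) : WithTop ℤ) ≤ u := by
  induction u with
  | top => simp
  | coe u =>
    rw [← WithTop.LinearOrderedAddCommGroup.coe_sub, WithTop.coe_le_coe, WithTop.coe_le_coe]
    omega

end Suprema

/-! ### Break filtrations of the truncated group -/

section TruncPow

theorem mk_truncPow {p : ℕ} {F S : Type*} [Field F] [CommRing S] [Algebra F S]
    (I : Ideal S) (x : S) (ω : F) :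
    Ideal.Quotient.mk I (truncPow p ω x) = truncPow p ω (Ideal.Quotient.mk I x) := by
  rw [← Ideal.Quotient.mkₐ_eq_mk F I]
  simp [truncPow]

variable {p : ℕ} [Fact p.Prime] {F S : Type*} [Field F] [CommRing S] [Algebra F S]

theorem exists_truncPow_sub_one_eq_mul (x : S) (ω : F) :
    ∃ β, truncPow p ω x - 1 = β * (x - 1) := by
  have h := truncPow_sub_one_mem (p := p) (Ideal.span {x - 1}) (Ideal.mem_span_singleton_self _) ω
  obtain ⟨β, hβ⟩ := Ideal.mem_span_singleton'.1 h
  exact ⟨β, hβ.symm⟩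

theorem exists_truncPow_sub_one_eq_smul_add (x : S) (ω : F) :
    ∃ β, truncPow p ω x - 1 = ω • (x - 1) + β * (x - 1) ^ 2 := by
  obtain ⟨q, rfl⟩ : ∃ q, p = q + 2 := Nat.exists_eq_add_of_le' (Fact.out : p.Prime).two_le
  refine ⟨∑ i ∈ Finset.range q, binom ω (i + 1 + 1) • (x - 1) ^ i, ?_⟩
  rw [truncPow, Finset.sum_range_succ', Finset.sum_range_succ', Finset.sum_mul]
  have h : ∀ i, binom ω (i + 1 + 1) • (x - 1) ^ (i + 1 + 1) =
      binom ω (i + 1 + 1) • (x - 1) ^ i * (x - 1) ^ 2 := fun i => by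
    rw [smul_mul_assoc, ← pow_add]
  simp only [h]
  simp [binom, add_comm]

end TruncPow

section Filtration

variable {p n k b : ℕ} {K L : Type*} [Fact p.Prime] [Fact (k ≤ p)] [Field K] [CharP K p] [Field L]
  [Algebra K L] [IsAbelianGalois K L]

/-- A decreasing family of left ideals of the group ring, given by its membership predicates. -/
structure IsShiftFiltration (Q : ℕ → GalRing p K L → Prop) : Prop where
  zero_mem : ∀ h, Q h 0
  add_mem : ∀ h α β, Q h α → Q h β → Q h (α + β)
  mul_mem : ∀ h α β, Q h β → Q h (α * β)
  anti : ∀ h α, Q (h + 1) α → Q h α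
  full : ∀ α, Q 0 α

/-- The filtration of the span of the image of the Galois group induced by a shift filtration of
the group ring: a class `γ` belongs to its `h`-th step if `γ' - 1` does for a representative
`γ'`. -/
noncomputable def breakFiltration (k : ℕ) [Fact (k ≤ p)] {Q : ℕ → GalRing p K L → Prop}
    (hQ : IsShiftFiltration Q)
    (h : ℕ) : Submodule (coeffField p K) (TruncGroup p k (coeffField p K) Gal(L/K)) where
  carrier := {γ | γ ∈ groupSpan p k (coeffField p K) Gal(L/K) ∧
    ∃ γ' ∈ reps (k := k) γ.val, Q h (γ' - 1)}
  zero_mem' := ⟨zero_mem _, 1, by rw [TruncGroup.val_zero]; exact map_one _,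
    by rw [sub_self]; exact hQ.zero_mem h⟩
  add_mem' := by
    rintro γ δ ⟨hγ, γ', hγ', h1⟩ ⟨hδ, δ', hδ', h2⟩
    refine ⟨add_mem hγ hδ, γ' * δ', ?_, ?_⟩
    · rw [reps, Set.mem_ofPred_eq] at hγ' hδ' ⊢
      rw [map_mul, hγ', hδ', TruncGroup.val_add]
    · have : γ' * δ' - 1 = γ' - 1 + γ' * (δ' - 1) := by ring
      rw [this]
      exact hQ.add_mem _ _ _ h1 (hQ.mul_mem _ _ _ h2)
  smul_mem' := by
    rintro ω γ ⟨hγ, γ', hγ', h1⟩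
    refine ⟨Submodule.smul_mem _ _ hγ, truncPow p ω γ', ?_, ?_⟩
    · rw [reps, Set.mem_ofPred_eq] at hγ' ⊢
      rw [mk_truncPow, hγ', TruncGroup.val_smul]
    · obtain ⟨β, hβ⟩ := exists_truncPow_sub_one_eq_mul (p := p) γ' ω
      rw [hβ]
      exact hQ.mul_mem _ _ _ h1

variable {Q : ℕ → GalRing p K L → Prop} (hQ : IsShiftFiltration Q)

theorem mem_breakFiltration {h : ℕ} {γ : TruncGroup p k (coeffField p K) Gal(L/K)} :
    γ ∈ breakFiltration k hQ h ↔ γ ∈ groupSpan p k (coeffField p K) Gal(L/K) ∧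
      ∃ γ' ∈ reps (k := k) γ.val, Q h (γ' - 1) := Iff.rfl

theorem breakFiltration_antitone : Antitone (breakFiltration k hQ) :=
  antitone_nat_of_succ_le fun h _ ⟨hγ, γ', hγ', h1⟩ => ⟨hγ, γ', hγ', hQ.anti h _ h1⟩

theorem breakFiltration_zero :
    breakFiltration k hQ 0 = groupSpan p k (coeffField p K) Gal(L/K) := by
  refine le_antisymm (fun γ hγ => hγ.1) fun γ hγ => ?_
  obtain ⟨γ', hγ'⟩ := Ideal.Quotient.mk_surjective γ.val
  exact ⟨hγ, γ', hγ', hQ.full _⟩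

variable [Valued L ℤᵐ⁰] {e : Gal(L/K) ≃* (Fin n → Multiplicative (ZMod p))} {ρ : L} {m : ℤ}

/-- The largest shift at `ρ` of a nontrivial class whose coordinates vanish outside `T`. -/
theorem ord_act_sub_one_le [FiniteDimensional K L] (hk : 2 ≤ k) (hB : HasBreakBound p b K L)
    (hb : 0 < b) (hρ : ord ρ = m)
    (htr : ord (∑ σ : Gal(L/K), σ ρ) = ((m + b * (Module.finrank K L - 1) : ℤ) : WithTop ℤ))
    {γ : TruncGroup p k (coeffField p K) Gal(L/K)}
    (hγ : γ ∈ groupSpan p k (coeffField p K) Gal(L/K)) (hγ0 : γ ≠ 0) {T : Finset (Fin n)}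
    (hT : ∀ j ∉ T, truncCoord e hk γ j = 0) {γ' : GalRing p K L} (hγ' : γ' ∈ reps (k := k) γ.val) :
    ord (act (γ' - 1) ρ) ≤ ((m + b * p ^ (T.card - 1) : ℤ) : WithTop ℤ) := by
  have h0 : truncCoord e hk γ ≠ 0 := by
    intro h
    apply hγ0
    rw [eq_sum_truncCoord_smul e hk hγ, h]
    simp
  obtain ⟨l, hl⟩ := Function.ne_iff.1 h0
  have hlT : l ∈ T := by
    by_contra hlT
    exact hl (hT l hlT)
  have hsnd : (linearization (coeffField p K) e (γ' - 1)).snd = truncCoord e hk γ := by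
    rw [truncCoord_eq_of_mk_eq e hk hγ', map_sub, map_one, TrivSqZeroExt.snd_sub,
      TrivSqZeroExt.snd_one, sub_zero]
  rw [← Finset.card_erase_of_mem hlT]
  refine ord_act_le hB hρ hb htr (Finset.notMem_erase l T) (sub_one_mem_augIdeal_of_mk_eq hk hγ')
    (by rwa [hsnd]) fun j hj => ?_
  rw [hsnd]
  rw [Finset.insert_erase hlT] at hj
  exact hT j hj

/-- A shift filtration which is dominated by the valuations of the values at an element with
smallest possible trace has `n` jumps, the `i`-th of which is at most `b p ^ i`. -/
theorem exists_breaks [FiniteDimensional K L] (e : Gal(L/K) ≃* (Fin n → Multiplicative (ZMod p)))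
    (hk : 2 ≤ k) (hB : HasBreakBound p b K L)
    (hb : 0 < b) (hρ : ord ρ = m)
    (htr : ord (∑ σ : Gal(L/K), σ ρ) = ((m + b * (Module.finrank K L - 1) : ℤ) : WithTop ℤ))
    (hQρ : ∀ h α, Q h α → ((m + h : ℤ) : WithTop ℤ) ≤ ord (act α ρ)) :
    ∃ c : Fin n → ℕ, Monotone c ∧
      {h | breakFiltration k hQ (h + 1) ≠ breakFiltration k hQ h} = Set.range c ∧
      (∀ h, Nat.card {i : Fin n // c i = h} =
        Module.finrank (coeffField p K) (breakFiltration k hQ h) -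
          Module.finrank (coeffField p K) (breakFiltration k hQ (h + 1))) ∧
      ∀ i : Fin n, c i ≤ b * p ^ (i : ℕ) := by
  have hfin : FiniteDimensional (coeffField p K) (groupSpan p k (coeffField p K) Gal(L/K)) :=
    Module.Finite.equiv (groupSpanEquiv e hk).symm
  have hrank : Module.finrank (coeffField p K) (groupSpan p k (coeffField p K) Gal(L/K)) = n := by
    rw [(groupSpanEquiv e hk).finrank_eq]
    simp
  rw [← breakFiltration_zero hQ] at hfin hrank
  have key : ∀ (T : Finset (Fin n)) (γ : TruncGroup p k (coeffField p K) Gal(L/K)),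
      (∀ j ∉ T, truncCoord e hk γ j = 0) →
      γ ∈ breakFiltration k hQ (b * p ^ (T.card - 1) + 1) → γ = 0 := by
    rintro T γ hT ⟨hγ, γ', hγ', h⟩
    by_contra hγ0
    have h1 := (hQρ _ _ h).trans (ord_act_sub_one_le hk hB hb hρ htr hγ hγ0 hT hγ')
    rw [WithTop.coe_le_coe] at h1
    push_cast at h1
    omega
  refine exists_jumps (breakFiltration_antitone hQ) hrank
    (H := b * p ^ ((Finset.univ : Finset (Fin n)).card - 1) + 1) ?_ _ fun i => ?_
  · rw [eq_bot_iff]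
    exact fun γ hγ => key Finset.univ γ (by simp) hγ
  · -- the coordinates with index greater than `i` are injective on this step
    let W := breakFiltration k hQ (b * p ^ (i : ℕ) + 1)
    let φ : W →ₗ[coeffField p K] ({j : Fin n // i < j} → coeffField p K) :=
      LinearMap.funLeft (coeffField p K) (coeffField p K) Subtype.val ∘ₗ
        (truncCoord e hk).domRestrict W
    have hφ : Function.Injective φ := by
      rw [← LinearMap.ker_eq_bot, LinearMap.ker_eq_bot']
      intro γ hγ
      have hT : ∀ j ∉ Finset.Iic i, truncCoord e hk γ.1 j = 0 := fun j hj =>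
        congrFun hγ ⟨j, by simpa using hj⟩
      refine Subtype.ext (key _ _ hT ?_)
      rw [Fin.card_Iic, Nat.add_sub_cancel]
      exact γ.2
    have h1 := LinearMap.finrank_le_finrank_of_injective hφ
    have h2 : Fintype.card {j : Fin n // i < j} = n - 1 - i := by
      rw [Fintype.card_subtype]
      have : Finset.univ.filter (fun j : Fin n => i < j) = Finset.Ioi i := by ext; simp
      rw [this, Fin.card_Ioi]
    rw [Module.finrank_fintype_fun_eq_card, h2] at h1
    have h3 : Module.finrank (coeffField p K) (breakFiltration k hQ (b * p ^ (i : ℕ) + 1)) ≤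
      n - 1 - i := h1
    have := i.2
    omega

end Filtration

/-! ### Refined breaks at a valuation criterion element -/

section Refined

variable {p n k b : ℕ} {K L : Type*} [Fact p.Prime] [Fact (k ≤ p)] [Field K] [CharP K p] [Field L]
  [Algebra K L] [Valued L ℤᵐ⁰] {ρ : L} {m : ℤ}

theorem isShiftFiltration_ord [IsAbelianGalois K L] (hB : HasBreakBound p b K L) (hρ : ord ρ = m) :
    IsShiftFiltration fun (h : ℕ) (α : GalRing p K L) =>
      ((m + h : ℤ) : WithTop ℤ) ≤ ord (act α ρ) where
  zero_mem h := by simp [act_zero, ord_zero]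
  add_mem h α β hα hβ := by
    rw [act_add]
    exact le_ord_add hα hβ
  mul_mem h α β hβ := by
    rw [act_mul]
    exact le_ord_act hB hβ α
  anti h α hα := le_trans (by norm_cast; omega) hα
  full α := le_ord_act hB (by simp [hρ]) α

/-- The leading term of `x` is a constant multiple of that of `y`, if `v(x) ≥ v(y)`. -/
theorem exists_le_ord_sub_mul (hres : ∀ z : L, 0 ≤ ord z →
    ∃ c : coeffField p K, 0 < ord (z - algebraMap K L c)) {x y : L} {r : ℤ} (hy : ord y = r)
    (hx : (r : WithTop ℤ) ≤ ord x) :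
    ∃ c : coeffField p K, ((r + 1 : ℤ) : WithTop ℤ) ≤ ord (x - algebraMap K L c * y) := by
  have hy0 := ne_zero_of_ord hy
  have h1 : ∀ z : L, ∀ l : ℤ, ((l + r : ℤ) : WithTop ℤ) ≤ ord z ↔
      (l : WithTop ℤ) ≤ ord (z * y⁻¹) := by
    intro z l
    rw [ord_mul, ord_inv hy]
    induction ord z with
    | top => simp
    | coe u => norm_cast; omega
  obtain ⟨c, hc⟩ := hres (x * y⁻¹) ((h1 x 0).1 (by simpa using hx))
  refine ⟨c, ?_⟩
  rw [add_comm r 1, h1, sub_mul, mul_inv_cancel_right₀ hy0]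
  simpa using coe_add_one_le_iff.2 (show ((0 : ℤ) : WithTop ℤ) < _ from hc)

variable [IsAbelianGalois K L]

/-- The valuation filtration at `ρ` has one-dimensional jumps: two classes with the same shift have
proportional leading coefficients, and their truncated powers have the same leading terms as their
scalar multiples. -/
theorem finrank_breakFiltration_ord_le [FiniteDimensional K L] (hk : 2 ≤ k)
    (e : Gal(L/K) ≃* (Fin n → Multiplicative (ZMod p))) (hb : 0 < b)
    (hB : HasBreakBound p b K L) (hρ : ord ρ = m) (hres : ∀ z : L, 0 ≤ ord z →
      ∃ c : coeffField p K, 0 < ord (z - algebraMap K L c)) (h : ℕ) :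
    Module.finrank (coeffField p K) (breakFiltration k (isShiftFiltration_ord hB hρ) h) ≤
      Module.finrank (coeffField p K)
        (breakFiltration k (isShiftFiltration_ord hB hρ) (h + 1)) + 1 := by
  have hQ := isShiftFiltration_ord hB hρ
  have hfin : FiniteDimensional (coeffField p K) (groupSpan p k (coeffField p K) Gal(L/K)) :=
    Module.Finite.equiv (groupSpanEquiv e hk).symm
  have hfin' : ∀ h, FiniteDimensional (coeffField p K) (breakFiltration k hQ h) := fun h =>
    Submodule.finiteDimensional_of_le
      ((breakFiltration_antitone hQ (Nat.zero_le h)).trans (breakFiltration_zero hQ).le)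
  have hle := breakFiltration_antitone (k := k) hQ (Nat.le_succ h)
  by_cases hex : breakFiltration k hQ h ≤ breakFiltration k hQ (h + 1)
  · exact (Submodule.finrank_mono hex).trans (Nat.le_succ _)
  obtain ⟨δ, hδ, hδ'⟩ := SetLike.not_le_iff_exists.1 hex
  have hsub : breakFiltration k hQ h ≤
      breakFiltration k hQ (h + 1) ⊔ Submodule.span (coeffField p K) {δ} := by
    intro γ hγ
    obtain ⟨hδX, δ', hδ1, hδ2⟩ := hδ
    obtain ⟨hγX, γ', hγ1, hγ2⟩ := hγ
    have hord : ord (act (δ' - 1) ρ) = ((m + h : ℤ) : WithTop ℤ) := by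
      refine le_antisymm ?_ hδ2
      by_contra hlt
      rw [not_le, ← coe_add_one_le_iff] at hlt
      refine hδ' ⟨hδX, δ', hδ1, ?_⟩
      change ((m + (h + 1 : ℕ) : ℤ) : WithTop ℤ) ≤ _
      rwa [Nat.cast_succ, ← add_assoc]
    -- `γ` times the truncated power of `δ` with exponent `-c` lies one step deeper
    obtain ⟨c, hc⟩ := exists_le_ord_sub_mul hres hord hγ2
    have hmem : γ + (-c) • δ ∈ breakFiltration k hQ (h + 1) := by
      refine ⟨add_mem hγX (Submodule.smul_mem _ _ hδX), γ' * truncPow p (-c) δ', ?_, ?_⟩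
      · rw [reps, Set.mem_ofPred_eq] at hγ1 hδ1 ⊢
        rw [map_mul, mk_truncPow, hγ1, hδ1, TruncGroup.val_add, TruncGroup.val_smul]
      · obtain ⟨β₁, hβ₁⟩ := exists_truncPow_sub_one_eq_mul (p := p) δ' (-c)
        obtain ⟨β₂, hβ₂⟩ := exists_truncPow_sub_one_eq_smul_add (p := p) δ' (-c)
        have hexp : γ' * truncPow p (-c) δ' - 1 = ((γ' - 1) + (-c) • (δ' - 1)) +
            ((γ' - 1) * (β₁ * (δ' - 1)) + β₂ * ((δ' - 1) * (δ' - 1))) := by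
          linear_combination hβ₂ + (γ' - 1) * hβ₁
        have hshift : ∀ (α β : GalRing p K L), α ∈ augIdeal (coeffField p K) Gal(L/K) →
            ((m + h : ℤ) : WithTop ℤ) ≤ ord (act β ρ) →
            ((m + (h + 1 : ℕ) : ℤ) : WithTop ℤ) ≤ ord (act (α * β) ρ) := by
          intro α β hα hβ
          rw [act_mul]
          refine le_trans ?_ (le_ord_act_of_mem hB (isFixedBy_empty (e := e) _) hβ hα)
          rw [Finset.card_empty, pow_zero, mul_one, WithTop.coe_le_coe]
          push_cast
          omega
        change ((m + (h + 1 : ℕ) : ℤ) : WithTop ℤ) ≤ _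
        rw [hexp, act_add]
        refine le_ord_add ?_ ?_
        · rw [act_add, act_smul]
          convert hc using 2
          · push_cast; ring
          · rw [Subfield.coe_neg, map_neg]
            ring
        · rw [act_add]
          refine le_ord_add (hshift _ _ (sub_one_mem_augIdeal_of_mk_eq hk hγ1) ?_) ?_
          · rw [act_mul]
            exact le_ord_act hB hδ2 _
          · rw [act_mul]
            exact le_ord_act hB (hshift _ _ (sub_one_mem_augIdeal_of_mk_eq hk hδ1) hδ2) _
    have : γ = (γ + (-c) • δ) + c • δ := by rw [neg_smul, neg_add_cancel_right]
    rw [this]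
    exact Submodule.add_mem_sup hmem (Submodule.smul_mem _ _ (Submodule.mem_span_singleton_self δ))
  refine (Submodule.finrank_mono hsub).trans
    ((Submodule.finrank_add_le_finrank_add_finrank _ _).trans (Nat.add_le_add_left ?_ _))
  exact (finrank_span_le_card _).trans (by simp)

/-- The supremum defining `iRho` is attained, since the shifts in a nontrivial class are bounded. -/
theorem isGreatest_iRho [FiniteDimensional K L] (hk : 2 ≤ k)
    (e : Gal(L/K) ≃* (Fin n → Multiplicative (ZMod p))) (hB : HasBreakBound p b K L) (hb : 0 < b)
    (hρ : ord ρ = m)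
    (htr : ord (∑ σ : Gal(L/K), σ ρ) = ((m + b * (Module.finrank K L - 1) : ℤ) : WithTop ℤ))
    {γ : TruncGroup p k (coeffField p K) Gal(L/K)}
    (hγ : γ ∈ groupSpan p k (coeffField p K) Gal(L/K)) (hγ0 : γ ≠ 0) :
    IsGreatest ((fun γ' : GalRing p K L => ord (act (γ' - 1) ρ)) '' reps (k := k) γ.val)
      (iRho ρ γ.val) := by
  refine isGreatest_sSup_withTop ?_
    (Or.inr ⟨m + b * p ^ ((Finset.univ : Finset (Fin n)).card - 1), ?_⟩)
  · obtain ⟨γ', hγ'⟩ := Ideal.Quotient.mk_surjective γ.val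
    exact ⟨_, γ', hγ', rfl⟩
  · rintro _ ⟨γ', hγ', rfl⟩
    exact ord_act_sub_one_le (e := e) (T := Finset.univ) hk hB hb hρ htr hγ hγ0 (by simp) hγ'

theorem refinedBreaks_eq [FiniteDimensional K L] (hk : 2 ≤ k)
    (e : Gal(L/K) ≃* (Fin n → Multiplicative (ZMod p))) (hB : HasBreakBound p b K L) (hb : 0 < b)
    (hρ : ord ρ = m)
    (htr : ord (∑ σ : Gal(L/K), σ ρ) = ((m + b * (Module.finrank K L - 1) : ℤ) : WithTop ℤ)) :
    refinedBreaks p k K L ρ = (fun h : ℕ => ((h : ℤ) : WithTop ℤ)) ''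
      {h | breakFiltration k (isShiftFiltration_ord hB hρ) (h + 1) ≠
        breakFiltration k (isShiftFiltration_ord hB hρ) h} := by
  have hQ := isShiftFiltration_ord hB hρ
  -- membership in the filtration is read off from `iRho`
  have hmem : ∀ (h : ℕ) (γ : TruncGroup p k (coeffField p K) Gal(L/K)),
      γ ∈ groupSpan p k (coeffField p K) Gal(L/K) → γ ≠ 0 →
      (γ ∈ breakFiltration k hQ h ↔ ((h : ℤ) : WithTop ℤ) ≤ iRho ρ γ.val - ord ρ) := by
    intro h γ hγ hγ0
    have hgr := isGreatest_iRho hk e hB hb hρ htr hγ hγ0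
    rw [hρ, le_sub_coe_iff, add_comm, mem_breakFiltration]
    constructor
    · rintro ⟨_, γ', hγ', h1⟩
      exact h1.trans (hgr.2 ⟨γ', hγ', rfl⟩)
    · intro h1
      obtain ⟨γ', hγ', h2⟩ := hgr.1
      exact ⟨hγ, γ', hγ', h1.trans h2.ge⟩
  ext u
  constructor
  · rintro ⟨γ, hγ, hγ0, rfl⟩
    have h0 : γ ∈ breakFiltration k hQ 0 := by rwa [breakFiltration_zero]
    rw [hmem 0 γ hγ hγ0] at h0
    obtain ⟨γ', hγ', h2⟩ := (isGreatest_iRho hk e hB hb hρ htr hγ hγ0).1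
    have h3 := ord_act_sub_one_le (e := e) (T := Finset.univ) hk hB hb hρ htr hγ hγ0 (by simp) hγ'
    have h4 : iRho ρ γ.val ≠ ⊤ := by
      rw [← h2]
      exact (lt_of_le_of_lt h3 (WithTop.coe_lt_top _)).ne
    obtain ⟨r, hr⟩ := WithTop.ne_top_iff_exists.1 h4
    have h5 : iRho ρ γ.val - ord ρ = ((r - m : ℤ) : WithTop ℤ) := by
      rw [← hr, hρ, WithTop.LinearOrderedAddCommGroup.coe_sub]
    have h6 := hmem (r - m).toNat γ hγ hγ0
    have h7 := hmem ((r - m).toNat + 1) γ hγ hγ0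
    rw [h5, WithTop.coe_le_coe] at h0 h6 h7
    refine ⟨(r - m).toNat, fun heq => ?_, ?_⟩
    · rw [heq, h6] at h7
      push_cast at h0 h7
      omega
    · rw [h5]
      simp only
      congr 1
      push_cast at h0
      omega
  · rintro ⟨h, hne, rfl⟩
    have hle := breakFiltration_antitone (k := k) hQ (Nat.le_succ h)
    obtain ⟨γ, hγ, hγ'⟩ := SetLike.exists_of_lt (lt_of_le_of_ne hle hne)
    have hγ0 : γ ≠ 0 := by
      rintro rfl
      exact hγ' (zero_mem _)
    have hγX := hγ.1
    refine ⟨γ, hγX, hγ0, ?_⟩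
    rw [hmem _ γ hγX hγ0] at hγ hγ'
    refine le_antisymm hγ (le_of_not_gt fun hlt => hγ' ?_)
    rw [← coe_add_one_le_iff] at hlt
    exact_mod_cast hlt

/-- There are exactly `n` refined breaks at an element with smallest possible trace. -/
theorem exists_refinedBreaks [FiniteDimensional K L] (hk : 2 ≤ k)
    (e : Gal(L/K) ≃* (Fin n → Multiplicative (ZMod p))) (hB : HasBreakBound p b K L) (hb : 0 < b)
    (hρ : ord ρ = m)
    (htr : ord (∑ σ : Gal(L/K), σ ρ) = ((m + b * (Module.finrank K L - 1) : ℤ) : WithTop ℤ))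
    (hres : ∀ z : L, 0 ≤ ord z → ∃ c : coeffField p K, 0 < ord (z - algebraMap K L c)) :
    ∃ c : Fin n → ℤ, StrictMono c ∧
      refinedBreaks p k K L ρ = Set.range (fun i => (c i : WithTop ℤ)) ∧
      ∀ i : Fin n, c i ≤ b * p ^ (i : ℕ) := by
  obtain ⟨c, hmono, hrange, hcard, hle⟩ := exists_breaks (k := k) (isShiftFiltration_ord hB hρ) e hk
    hB hb hρ htr fun _ _ h => h
  refine ⟨fun i => c i, ?_, ?_, fun i => by
    simpa using Nat.cast_le (α := ℤ).2 (hle i)⟩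
  · have hinj : Function.Injective c := by
      intro i j hij
      have h1 := hcard (c i)
      have h2 := finrank_breakFiltration_ord_le hk e hb hB hρ hres (c i)
      have h3 : Nat.card {l : Fin n // c l = c i} ≤ 1 := by omega
      have h4 := Finite.card_le_one_iff_subsingleton.1 h3
      have h5 := h4.elim ⟨i, rfl⟩ ⟨j, hij.symm⟩
      exact congrArg Subtype.val h5
    exact fun i j hij => Nat.cast_lt.2 (hmono.strictMono_of_injective hinj hij)
  · rw [refinedBreaks_eq hk e hB hb hρ htr, hrange, ← Set.range_comp]
    rfl

end Refined

/-! ### Smallest-shift breaks -/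

section SmallestShift

variable {p n k b : ℕ} {K L : Type*} [Fact p.Prime] [Field K] [CharP K p] [Field L]
  [Algebra K L] [Valued L ℤᵐ⁰] {ρ : L} {m : ℤ}

theorem le_vHat_iff (hB : HasBreakBound p b K L) {h : ℤ} {α : GalRing p K L} :
    (h : WithTop ℤ) ≤ vHat α ↔
      ∀ (x : L) (r : ℤ), ord x = r → ((h + r : ℤ) : WithTop ℤ) ≤ ord (act α x) := by
  have hbdd : BddBelow {m | ∃ x : L, x ≠ 0 ∧ m = ord (act α x) - ord x} := by
    refine ⟨((0 : ℤ) : WithTop ℤ), ?_⟩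
    rintro _ ⟨x, hx, rfl⟩
    obtain ⟨r, hr⟩ := exists_ord_eq hx
    rw [hr, le_sub_coe_iff, zero_add]
    exact le_ord_act hB hr.ge α
  rw [vHat, le_csInf_iff hbdd ⟨_, 1, one_ne_zero, rfl⟩]
  constructor
  · intro H x r hr
    have := H _ ⟨x, ne_zero_of_ord hr, rfl⟩
    rwa [hr, le_sub_coe_iff] at this
  · rintro H _ ⟨x, hx, rfl⟩
    obtain ⟨r, hr⟩ := exists_ord_eq hx
    rw [hr, le_sub_coe_iff]
    exact H x r hr

theorem isShiftFiltration_vHat [IsAbelianGalois K L] (hB : HasBreakBound p b K L) :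
    IsShiftFiltration fun (h : ℕ) (α : GalRing p K L) => ((h : ℤ) : WithTop ℤ) ≤ vHat α where
  zero_mem h := by
    rw [le_vHat_iff hB]
    intro x r _
    simp [act_zero, ord_zero]
  add_mem h α β hα hβ := by
    rw [le_vHat_iff hB] at hα hβ ⊢
    intro x r hr
    rw [act_add]
    exact le_ord_add (hα x r hr) (hβ x r hr)
  mul_mem h α β hβ := by
    rw [le_vHat_iff hB] at hβ ⊢
    intro x r hr
    rw [act_mul]
    exact le_ord_act hB (hβ x r hr) α
  anti h α hα := le_trans (by norm_cast; omega) hα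
  full α := by
    rw [le_vHat_iff hB]
    intro x r hr
    exact le_ord_act hB (by simp [hr]) α

theorem le_ord_act_of_le_vHat (hB : HasBreakBound p b K L) (hρ : ord ρ = m) (h : ℕ)
    (α : GalRing p K L) (hα : ((h : ℤ) : WithTop ℤ) ≤ vHat α) :
    ((m + h : ℤ) : WithTop ℤ) ≤ ord (act α ρ) := by
  rw [add_comm]
  exact (le_vHat_iff hB).1 hα ρ m hρ

variable [IsAbelianGalois K L] [Fact (k ≤ p)]

theorem ssFiltration_eq [FiniteDimensional K L] (hk : 2 ≤ k)
    (e : Gal(L/K) ≃* (Fin n → Multiplicative (ZMod p))) (hB : HasBreakBound p b K L) (hb : 0 < b)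
    (hρ : ord ρ = m)
    (htr : ord (∑ σ : Gal(L/K), σ ρ) = ((m + b * (Module.finrank K L - 1) : ℤ) : WithTop ℤ))
    (h : ℕ) :
    ssFiltration p k K L h = breakFiltration k (isShiftFiltration_vHat hB) h := by
  ext γ
  rw [SetLike.mem_coe, mem_breakFiltration, ssFiltration, Set.mem_ofPred_eq]
  refine and_congr_right fun hγ => ?_
  have hreps : ∀ {α : GalRing p K L}, α ∈ reps (k := k) (γ.val - 1) ↔
      α + 1 ∈ reps (k := k) γ.val := by
    intro α
    rw [reps, reps, Set.mem_ofPred_eq, Set.mem_ofPred_eq, map_add, map_one, eq_sub_iff_add_eq]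
  have hgr : IsGreatest (vHat '' reps (k := k) (γ.val - 1)) (vHatQuot (γ.val - 1)) := by
    refine isGreatest_sSup_withTop ?_ ?_
    · obtain ⟨α, hα⟩ := Ideal.Quotient.mk_surjective (γ.val - 1)
      exact ⟨_, α, hα, rfl⟩
    · rcases eq_or_ne γ 0 with rfl | hγ0
      · refine Or.inl ⟨0, ?_, ?_⟩
        · rw [TruncGroup.val_zero, sub_self]
          exact map_zero _
        · rw [← top_le_iff]
          exact withTop_le_of_forall_coe_le fun h _ => by
            rw [le_vHat_iff hB]
            intro x r _
            simp [act_zero, ord_zero]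
      · refine Or.inr ⟨b * p ^ ((Finset.univ : Finset (Fin n)).card - 1), ?_⟩
        rintro _ ⟨α, hα, rfl⟩
        have h1 := ord_act_sub_one_le (e := e) (T := Finset.univ) hk hB hb hρ htr hγ hγ0 (by simp)
          (hreps.1 hα)
        rw [add_sub_cancel_right] at h1
        by_contra hlt
        rw [not_le, ← coe_add_one_le_iff, le_vHat_iff hB] at hlt
        have h2 := (hlt ρ m hρ).trans h1
        rw [WithTop.coe_le_coe] at h2
        omega
  constructor
  · intro h1
    obtain ⟨α, hα, h2⟩ := hgr.1
    refine ⟨α + 1, hreps.1 hα, ?_⟩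
    rw [add_sub_cancel_right, h2]
    exact h1
  · rintro ⟨γ', hγ', h1⟩
    exact h1.trans (hgr.2 ⟨γ' - 1, hreps.2 (by rwa [sub_add_cancel]), rfl⟩)

/-- Counted with multiplicity there are exactly `n` smallest-shift breaks. -/
theorem exists_ssBreaks [FiniteDimensional K L] (hk : 2 ≤ k)
    (e : Gal(L/K) ≃* (Fin n → Multiplicative (ZMod p))) (hB : HasBreakBound p b K L) (hb : 0 < b)
    (hρ : ord ρ = m)
    (htr : ord (∑ σ : Gal(L/K), σ ρ) = ((m + b * (Module.finrank K L - 1) : ℤ) : WithTop ℤ)) :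
    ∃ c : Fin n → ℕ, Monotone c ∧ ssBreaks p k K L = Set.range c ∧
      (∀ h : ℕ, Nat.card {i : Fin n // c i = h} = ssMultiplicity p k K L h) ∧
      ∀ i : Fin n, c i ≤ b * p ^ (i : ℕ) := by
  have hQ := isShiftFiltration_vHat hB
  obtain ⟨c, hmono, hrange, hcard, hle⟩ := exists_breaks (k := k) hQ e hk
    hB hb hρ htr (le_ord_act_of_le_vHat hB hρ)
  refine ⟨c, hmono, ?_, fun h => ?_, hle⟩
  · rw [← hrange]
    ext h
    rw [ssBreaks, Set.mem_ofPred_eq, Set.mem_ofPred_eq, ssFiltration_eq hk e hB hb hρ htr,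
      ssFiltration_eq hk e hB hb hρ htr, Ne, SetLike.coe_set_eq]
  · have hfin : FiniteDimensional (coeffField p K) (groupSpan p k (coeffField p K) Gal(L/K)) :=
      Module.Finite.equiv (groupSpanEquiv e hk).symm
    have hfin' : FiniteDimensional (coeffField p K) (breakFiltration k hQ h) :=
      Submodule.finiteDimensional_of_le
        ((breakFiltration_antitone hQ (Nat.zero_le h)).trans (breakFiltration_zero hQ).le)
    rw [hcard, ssMultiplicity, ssFiltration_eq hk e hB hb hρ htr,
      ssFiltration_eq hk e hB hb hρ htr, Submodule.span_eq, Submodule.span_eq,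
      finrank_quotient_submoduleOf (breakFiltration_antitone hQ (Nat.le_succ h))]

end SmallestShift

end RefinedBreaks

open RefinedBreaks in
theorem mainTheorem5 (p n k b : ℕ) [Fact p.Prime] (hk : 2 ≤ k) [Fact (k ≤ p)] (hb : 0 < b)
    (K L : Type*) [Field K] [CharP K p] [Valued K ℤᵐ⁰] [CompleteSpace K]
    (hK : Function.Surjective (Valued.v : Valuation K ℤᵐ⁰)) [PerfectField 𝓀[K]]
    [Field L] [Valued L ℤᵐ⁰] (hL : Function.Surjective (Valued.v : Valuation L ℤᵐ⁰))
    [Algebra K L] [FiniteDimensional K L] [IsAbelianGalois K L]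
    (hG : Nonempty (Gal(L/K) ≃* (Fin n → Multiplicative (ZMod p))))
    (hram : IsTotallyRamified K L) (hbreak : lowerBreaks K L = {(b : ℤ)}) :
    (∀ ρ : L, IsValuationCriterion K L b ρ →
      ∃ c : Fin n → ℤ, StrictMono c ∧
        refinedBreaks p k K L ρ = Set.range (fun i => (c i : WithTop ℤ)) ∧
        ∀ i : Fin n, c i ≤ b * p ^ (i : ℕ)) ∧
    (∃ c : Fin n → ℕ, Monotone c ∧ ssBreaks p k K L = Set.range c ∧
        (∀ h : ℕ, Nat.card {i : Fin n // c i = h} = ssMultiplicity p k K L h) ∧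
        ∀ i : Fin n, c i ≤ b * p ^ (i : ℕ)) ∧
    (VCBreaksDefined p k K L b →
      ∃ c : Fin n → ℤ, StrictMono c ∧
        vcBreaks p k K L b = Set.range (fun i => (c i : WithTop ℤ)) ∧
        ∀ i : Fin n, c i ≤ b * p ^ (i : ℕ)) := by
  obtain ⟨e⟩ := hG
  obtain ⟨π, hπ⟩ := exists_ord hL 1
  have hB : HasBreakBound p b K L :=
    { ord_galois := ord_galois hK hram hπ
      ord_coeff := fun c hc => by
        have h0 : ord (c : K) = ((0 : ℤ) : WithTop ℤ) := ord_coeffField p c hc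
        rw [ord_algebraMap hram h0, mul_zero]
        rfl
      le_ord_sub := fun H y hy σ m hm =>
        le_ord_galois_sub_of_fixed hK hram hπ hbreak H hy σ hm }
  have htr : ∀ (ρ : L) (m : ℤ), ord ρ = m → m ≡ b [ZMOD (Module.finrank K L : ℤ)] →
      ord (∑ σ : Gal(L/K), σ ρ) = ((m + b * (Module.finrank K L - 1) : ℤ) : WithTop ℤ) :=
    fun ρ m hρ hm => ord_trace_of_modEq p hK hram hπ hbreak
      (fun y l hl => le_ord_trace e hB hl) hρ hm
  have hvc : ∀ ρ : L, IsValuationCriterion K L b ρ → ∃ c : Fin n → ℤ, StrictMono c ∧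
      refinedBreaks p k K L ρ = Set.range (fun i => (c i : WithTop ℤ)) ∧
      ∀ i : Fin n, c i ≤ b * p ^ (i : ℕ) := by
    rintro ρ ⟨m, hρ, hm⟩
    exact exists_refinedBreaks hk e hB hb hρ (htr ρ m hρ hm)
      (exists_algebraMap_sub_ord_pos p hram hπ)
  have hπb : ord (π ^ b) = ((b : ℤ) : WithTop ℤ) := ord_pow_uniformizer hπ b
  refine ⟨hvc, exists_ssBreaks hk e hB hb hπb (htr _ _ hπb rfl), fun hdef => ?_⟩
  obtain ⟨c, hc, hc', hc''⟩ := hvc (π ^ b) ⟨b, hπb, rfl⟩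
  refine ⟨c, hc, ?_, hc''⟩
  rw [← hc']
  ext h
  constructor
  · rintro ⟨ρ, hρ, hh⟩
    rwa [hdef (π ^ b) ρ ⟨b, hπb, rfl⟩ hρ]
  · exact fun hh => ⟨π ^ b, ⟨b, hπb, rfl⟩, hh⟩
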